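/- Let $E$ be an elliptic curve over $\mathbb{Q}$ with discriminant $\Delta$, and let $\Delta_{sf}$ be the square-free integer such that $\Delta/\Delta_{sf}$ is the square of a rational number. Fix compatible $\mathbb{Z}/n\mathbb{Z}$-bases of the groups $E[n]$ ($n\ge 1$), and let $\varphi_E: \mathrm{Gal}(\overline{\mathbb{Q}}/\mathbb{Q})\to GL_2(\hat{\mathbb{Z}})$ be the resulting torsion representation, $G_n(E)\subseteq GL_2(\mathbb{Z}/n\mathbb{Z})$ the image of its reduction modulo $n$. Put $M_E=2|\Delta_{sf}|$ if $\Delta_{sf}\equiv 1 \bmod 4$ and $M_E=4|\Delta_{sf}|$ otherwise. Let $\varepsilon$ be the character of $GL_2(\mathbb{Z}/M_E\mathbb{Z})$ obtained by reduction modulo $2$ followed by the signature on $GL_2(\mathbb{Z}/2\mathbb{Z})\simeq S_3$, let $\left(\frac{\Delta_{sf}}{\det(\cdot)}\right)$ be the quadratic (Kronecker symbol) character of the determinant (trivial if $\Delta_{sf}=1$), and let $H_E\subseteq GL_2(\hat{\mathbb{Z}})$ be the full preimage of $\ker\left(\varepsilon(\cdot)\left(\frac{\Delta_{sf}}{\det(\cdot)}\right)\right)$.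 Suppose that $E$ is a Serre curve, i.e. that the image of $\varphi_E$ is $H_E$. Let $m_E$ be the smallest positive integer $m$ such that the image of $\varphi_E$ is the full preimage of $G_m(E)$ in $GL_2(\hat{\mathbb{Z}})$. For $G\subseteq GL_2(\mathbb{Z}/n\mathbb{Z})$ and $r\in\mathbb{Z}$ let $G_r=\{g\in G: \mathrm{tr}\, g\equiv r \bmod n\}$, and let $\Phi_n=\{g\in GL_2(\mathbb{Z}/n\mathbb{Z}):\det(1-g)\in(\mathbb{Z}/n\mathbb{Z})^*\}$. With $\ell$ running over primes, define $$C_{E,r}=\frac{2}{\pi}\cdot\frac{m_E|G_{m_E}(E)_r|}{|G_{m_E}(E)|}\prod_{\ell\nmid m_E}\frac{\ell\,|GL_2(\mathbb{Z}/\ell\mathbb{Z})_r|}{|GL_2(\mathbb{Z}/\ell\mathbb{Z})|},\qquad C_r=\frac{2}{\pi}\prod_{\ell\mid r}\left(1+\frac{1}{\ell^2-1}\right)\prod_{\ell\nmid r}\left(1-\frac{1}{(\ell-1)(\ell^2-1)}\right),$$ $$C_{E,\mathrm{prime}}=\frac{|G_{m_E}(E)\cap\Phi_{m_E}|/|G_{m_E}(E)|}{\prod_{\ell\mid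 m_E}(1-1/\ell)}\prod_{\ell\nmid m_E}\frac{|\Phi_\ell|/|GL_2(\mathbb{Z}/\ell\mathbb{Z})|}{1-1/\ell},\qquad C_{\mathrm{prime}}=\prod_{\ell}\left(1-\frac{\ell^2-\ell-1}{(\ell-1)^3(\ell+1)}\right),$$ $$C_{E,\mathrm{cyclic}}=\sum_{n\ge1}\frac{\mu(n)}{|G_n(E)|},\qquad C_{\mathrm{cyclic}}=\prod_\ell\left(1-\frac{1}{\ell(\ell-1)^2(\ell+1)}\right).$$ Let $W=|\Delta_{sf}|/(\Delta_{sf},2)$ and let $k=1,2,3$ according as $\Delta_{sf}\equiv 1,3,2 \bmod 4$, so that $M_E=2^kW$. Let $\chi_4$ be the non-trivial Dirichlet character modulo $4$, with the convention $\chi_4(x)=1$ for $x\notin\mathbb{Z}$, let $\omega(n)$ be the number of distinct prime divisors of $n$, $\varphi$ Euler's function, and, for $2^{k-1}\mid r$, $$\delta(\Delta_{sf},r)=(-1)^{\omega\left(\frac{W}{(W,r)}\right)+\frac{W+1}{2}+\frac{r}{2^{k-1}}}\cdot\chi_4\left(-\frac{\Delta_{sf}}{2}\right).$$ Then all these infinite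 products and the series converge unconditionally, and: - for every integer $r$, $C_{E,r}=C_r\left(1+\delta(\Delta_{sf},r)\cdot\frac{M_E\cdot 2^{k-1}\cdot\varphi((W,r))}{|GL_2(\mathbb{Z}/M_E\mathbb{Z})_r|}\right)$ if $2^{k-1}\mid r$, and $C_{E,r}=C_r$ otherwise; - $C_{E,\mathrm{prime}}=C_{\mathrm{prime}}\left(1+\prod_{p\mid\Delta_{sf}}\frac{1}{p^3-2p^2-p+3}\right)$ if $\Delta_{sf}\equiv1\bmod 4$, and $C_{E,\mathrm{prime}}=C_{\mathrm{prime}}$ otherwise; - $C_{E,\mathrm{cyclic}}=C_{\mathrm{cyclic}}\left(1+\frac{\mu(M_E)}{\prod_{\ell\mid M_E}\left(|GL_2(\mathbb{Z}/\ell\mathbb{Z})|-1\right)}\right)$ if $\Delta_{sf}\equiv1\bmod4$, and $C_{E,\mathrm{cyclic}}=C_{\mathrm{cyclic}}$ otherwise. -/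

import Mathlib

open scoped WeierstrassCurve.Affine

noncomputable section

namespace SerreCurve

/-! ### The ring of profinite integers -/

/-- The ring `Ẑ = lim ℤ/nℤ` of profinite integers: families of residue classes, one modulo each
positive integer, that are compatible under reduction. -/
def ZHat : Subring (∀ n : ℕ+, ZMod n) where
  carrier := {x | ∀ (n m : ℕ+) (h : (n : ℕ) ∣ m), ZMod.castHom h (ZMod n) (x m) = x n}
  mul_mem' {a b} ha hb n m h := by
    simp only [Pi.mul_apply, map_mul, ha n m h, hb n m h]
  one_mem' n m h := by simp only [Pi.one_apply, map_one]
  add_mem' {a b} ha hb n m h := by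
    simp only [Pi.add_apply, map_add, ha n m h, hb n m h]
  zero_mem' n m h := by simp only [Pi.zero_apply, map_zero]
  neg_mem' {a} ha n m h := by simp only [Pi.neg_apply, map_neg, ha n m h]

/-- The projection `Ẑ → ℤ/nℤ`. -/
def ZHat.proj (n : ℕ+) : ZHat →+* ZMod n :=
  (Pi.evalRingHom (fun n : ℕ+ => ZMod n) n).comp ZHat.subtype

/-- The natural projection `π : GL₂(Ẑ) → GL₂(ℤ/nℤ)`. -/
def reduction (n : ℕ+) : GL (Fin 2) ZHat →* GL (Fin 2) (ZMod n) :=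
  Matrix.GeneralLinearGroup.map (ZHat.proj n)

/-! ### Torsion points and the torsion representation -/

/-- The algebraic closure of `ℚ`. -/
abbrev QBar : Type := AlgebraicClosure ℚ

instance : DecidableEq QBar := Classical.decEq _

/-- The group `E[n]` of `n`-torsion points of `E` over the algebraic closure of `ℚ`. -/
def torsion (E : WeierstrassCurve ℚ) (n : ℕ+) : AddSubgroup (E⁄QBar).Point where
  carrier := {P | (n : ℕ) • P = 0}
  add_mem' {a b} (ha : (n : ℕ) • a = 0) (hb : (n : ℕ) • b = 0) := by
    change (n : ℕ) • (a + b) = 0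
    rw [nsmul_add, ha, hb, add_zero]
  zero_mem' := nsmul_zero _
  neg_mem' {a} (ha : (n : ℕ) • a = 0) := by
    change (n : ℕ) • (-a) = 0
    rw [neg_nsmul, ha, neg_zero]

/-- The action of an element of the absolute Galois group of `ℚ` on `E[n]`. -/
def galoisAct (E : WeierstrassCurve ℚ) (n : ℕ+) (σ : Field.absoluteGaloisGroup ℚ) :
    torsion E n →+ torsion E n :=
  ((WeierstrassCurve.Affine.Point.map (W' := E) (S := ℚ) (F := QBar) (K := QBar)
      (AlgEquiv.toAlgHom (σ : QBar ≃ₐ[ℚ] QBar))).comp (torsion E n).subtype).codRestrict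
    (torsion E n) (fun P => by
      change (n : ℕ) • (WeierstrassCurve.Affine.Point.map (W' := E) (S := ℚ) (F := QBar) (K := QBar)
        (AlgEquiv.toAlgHom (σ : QBar ≃ₐ[ℚ] QBar)) (P : (E⁄QBar).Point)) = 0
      rw [← map_nsmul, show (n : ℕ) • (P : (E⁄QBar).Point) = 0 from P.2, map_zero])

/-- A compatible choice of bases of the free `ℤ/nℤ`-modules `E[n]` of rank two, that is, a
`Ẑ`-basis of the Tate module `lim E[n]`: coordinates on every `E[n]`, such that for `n ∣ m`
multiplication by `m / n`, as a map `E[m] → E[n]`, is reduction of coordinates. -/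
structure TorsionBasis (E : WeierstrassCurve ℚ) where
  coord (n : ℕ+) : torsion E n ≃+ (Fin 2 → ZMod n)
  compat (n m : ℕ+) (h : (n : ℕ) ∣ m) (P : torsion E m) (Q : torsion E n)
    (hPQ : (Q : (E⁄QBar).Point) = ((m : ℕ) / (n : ℕ)) • (P : (E⁄QBar).Point)) (i : Fin 2) :
    coord n Q i = ZMod.castHom h (ZMod n) (coord m P i)

variable {E : WeierstrassCurve ℚ}

/-- The endomorphism of `(ℤ/nℤ)²` by which `σ` acts on `E[n]`, in coordinates. -/
def actEnd (b : TorsionBasis E) (n : ℕ+) (σ : Field.absoluteGaloisGroup ℚ) :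
    (Fin 2 → ZMod n) →ₗ[ZMod n] (Fin 2 → ZMod n) :=
  AddMonoidHom.toZModLinearMap n
    (((b.coord n).toAddMonoidHom.comp (galoisAct E n σ)).comp (b.coord n).symm.toAddMonoidHom)

theorem galoisAct_coe (n : ℕ+) (σ : Field.absoluteGaloisGroup ℚ) (P : torsion E n) :
    (galoisAct E n σ P : (E⁄QBar).Point) =
      WeierstrassCurve.Affine.Point.map (W' := E) (S := ℚ) (F := QBar) (K := QBar)
        (AlgEquiv.toAlgHom (σ : QBar ≃ₐ[ℚ] QBar)) (P : (E⁄QBar).Point) := rfl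

theorem galoisAct_one (n : ℕ+) (P : torsion E n) : galoisAct E n 1 P = P := by
  apply Subtype.ext
  rw [galoisAct_coe]
  rcases (P : (E⁄QBar).Point) with _ | _ <;> rfl

theorem galoisAct_mul (n : ℕ+) (σ τ : Field.absoluteGaloisGroup ℚ) (P : torsion E n) :
    galoisAct E n (σ * τ) P = galoisAct E n σ (galoisAct E n τ P) := by
  apply Subtype.ext
  rw [galoisAct_coe, galoisAct_coe, galoisAct_coe]
  rcases (P : (E⁄QBar).Point) with _ | _ <;> rfl

theorem actEnd_apply (b : TorsionBasis E) (n : ℕ+) (σ : Field.absoluteGaloisGroup ℚ)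
    (v : Fin 2 → ZMod n) :
    actEnd b n σ v = b.coord n (galoisAct E n σ ((b.coord n).symm v)) := rfl

theorem actEnd_one (b : TorsionBasis E) (n : ℕ+) : actEnd b n 1 = LinearMap.id := by
  apply LinearMap.ext
  intro v
  rw [actEnd_apply, galoisAct_one, AddEquiv.apply_symm_apply, LinearMap.id_apply]

theorem actEnd_mul (b : TorsionBasis E) (n : ℕ+) (σ τ : Field.absoluteGaloisGroup ℚ) :
    actEnd b n (σ * τ) = (actEnd b n σ).comp (actEnd b n τ) := by
  apply LinearMap.ext
  intro v
  rw [LinearMap.comp_apply, actEnd_apply, actEnd_apply, actEnd_apply, galoisAct_mul,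
    AddEquiv.symm_apply_apply]

/-- The matrix, with respect to the chosen basis, of the action of `σ` on `E[n]`. -/
def actMatrix (b : TorsionBasis E) (n : ℕ+) (σ : Field.absoluteGaloisGroup ℚ) :
    Matrix (Fin 2) (Fin 2) (ZMod n) :=
  LinearMap.toMatrix' (actEnd b n σ)

theorem actMatrix_compat (b : TorsionBasis E) (σ : Field.absoluteGaloisGroup ℚ) (i j : Fin 2)
    (n m : ℕ+) (h : (n : ℕ) ∣ m) :
    ZMod.castHom h (ZMod n) (actMatrix b m σ i j) = actMatrix b n σ i j := by
  simp only [actMatrix, LinearMap.toMatrix'_apply, actEnd_apply]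
  symm
  apply b.compat n m h
  rw [galoisAct_coe, galoisAct_coe, ← map_nsmul]
  congr 1
  have hmem : ((m : ℕ) / (n : ℕ)) •
      ((b.coord m).symm (Pi.single j 1) : (E⁄QBar).Point) ∈ torsion E n := by
    change (n : ℕ) • (((m : ℕ) / (n : ℕ)) •
      ((b.coord m).symm (Pi.single j 1) : (E⁄QBar).Point)) = 0
    rw [smul_smul, Nat.mul_div_cancel' h]
    exact ((b.coord m).symm (Pi.single j 1)).2
  have key : (b.coord n).symm (Pi.single j 1) = ⟨_, hmem⟩ := by
    rw [AddEquiv.symm_apply_eq]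
    funext i
    rw [b.compat n m h _ ⟨_, hmem⟩ rfl i, AddEquiv.apply_symm_apply]
    by_cases hij : i = j
    · subst hij
      rw [Pi.single_eq_same, Pi.single_eq_same, map_one]
    · rw [Pi.single_eq_of_ne hij, Pi.single_eq_of_ne hij, map_zero]
  rw [key]

/-- The mod `n` torsion representation `φ_{E,n} : G_ℚ → GL₂(ℤ/nℤ)`. -/
def modRep (b : TorsionBasis E) (n : ℕ+) :
    Field.absoluteGaloisGroup ℚ →* GL (Fin 2) (ZMod n) :=
  MonoidHom.toHomUnits
    { toFun := actMatrix b n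
      map_one' := by rw [actMatrix, actEnd_one, LinearMap.toMatrix'_id]
      map_mul' := fun σ τ => by
        rw [actMatrix, actEnd_mul, LinearMap.toMatrix'_comp, actMatrix, actMatrix] }

/-- The torsion representation `φ_E : G_ℚ → GL₂(Ẑ)`, the inverse limit of the `φ_{E,n}`. -/
def adelicRep (b : TorsionBasis E) : Field.absoluteGaloisGroup ℚ →* GL (Fin 2) ZHat :=
  MonoidHom.toHomUnits
    { toFun := fun σ => Matrix.of fun i j =>
        ⟨fun n => (modRep b n σ).1 i j, fun n m h => actMatrix_compat b σ i j n m h⟩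
      map_one' := by
        apply Matrix.ext
        intro i j
        apply Subtype.ext
        funext n
        by_cases hij : i = j
        · subst hij
          simp
        · simp [hij]
      map_mul' := fun σ τ => by
        apply Matrix.ext
        intro i j
        apply Subtype.ext
        funext n
        simp [Matrix.mul_apply, Fin.sum_univ_two] }

/-- `φ_E` reduces to `φ_{E,n}` modulo `n`. -/
theorem reduction_adelicRep (b : TorsionBasis E) (n : ℕ+) (σ : Field.absoluteGaloisGroup ℚ) :
    reduction n (adelicRep b σ) = modRep b n σ := by
  ext i j
  rfl

/-- `G_n(E) ⊆ GL₂(ℤ/nℤ)`, the image of the mod `n` representation, which is the Galois group of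
the `n`-th division field of `E`. -/
def galImage (b : TorsionBasis E) (n : ℕ+) : Subgroup (GL (Fin 2) (ZMod n)) :=
  (modRep b n).range

/-- `m` is a level of the image of `φ_E`: that image is the full preimage of `G_m(E)`. -/
def IsLevel (b : TorsionBasis E) (m : ℕ+) : Prop :=
  (adelicRep b).range = (galImage b m).comap (reduction m)

open Classical in
/-- The smallest level `m_E`. A level exists when `E` has no complex multiplication (in particular
for Serre curves); where there is none, the value `1` has no meaning. -/
def minLevel (b : TorsionBasis E) : ℕ+ :=
  if h : ∃ m : ℕ+, IsLevel b m then PNat.find h else 1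

/-! ### The constants of an elliptic curve without complex multiplication -/

/-- The number of elements of `G` of trace `r` modulo `n`. -/
def traceCount {n : ℕ+} (G : Subgroup (GL (Fin 2) (ZMod n))) (r : ℤ) : ℕ :=
  Nat.card {g : GL (Fin 2) (ZMod n) // g ∈ G ∧ Matrix.trace g.1 = (r : ZMod n)}

/-- The number of elements of `G ∩ Φ_n`, where `Φ_n` is the set of `g ∈ GL₂(ℤ/nℤ)` such that
`det (1 - g)` is a unit. -/
def koblitzCount {n : ℕ+} (G : Subgroup (GL (Fin 2) (ZMod n))) : ℕ :=
  Nat.card {g : GL (Fin 2) (ZMod n) // g ∈ G ∧ IsUnit (Matrix.det (1 - g.1))}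

/-- A prime number as a positive integer. -/
def primePos (l : Nat.Primes) : ℕ+ := ⟨l, l.2.pos⟩

/-- The factor `ℓ |GL₂(ℤ/ℓℤ)_r| / |GL₂(ℤ/ℓℤ)|`. -/
def langTrotterFactor (r : ℤ) (l : Nat.Primes) : ℝ :=
  (l : ℝ) * traceCount (n := primePos l) ⊤ r / Nat.card (GL (Fin 2) (ZMod (primePos l)))

/-- The factor `(|Φ_ℓ| / |GL₂(ℤ/ℓℤ)|) / (1 - 1/ℓ)`. -/
def koblitzFactor (l : Nat.Primes) : ℝ :=
  ((koblitzCount (n := primePos l) ⊤ : ℝ) / Nat.card (GL (Fin 2) (ZMod (primePos l)))) /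
    (1 - 1 / (l : ℝ))

/-- The Lang–Trotter constant `C_{E,r}`. -/
def langTrotterConst (b : TorsionBasis E) (r : ℤ) : ℝ :=
  2 / Real.pi *
    ((minLevel b : ℕ) * traceCount (galImage b (minLevel b)) r /
      Nat.card (galImage b (minLevel b))) *
    ∏' l : {l : Nat.Primes // ¬ (l : ℕ) ∣ minLevel b}, langTrotterFactor r l

/-- The Koblitz constant `C_{E,prime}`. -/
def koblitzConst (b : TorsionBasis E) : ℝ :=
  ((koblitzCount (galImage b (minLevel b)) : ℝ) / Nat.card (galImage b (minLevel b))) /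
      (∏ l ∈ (minLevel b : ℕ).primeFactors, (1 - 1 / (l : ℝ))) *
    ∏' l : {l : Nat.Primes // ¬ (l : ℕ) ∣ minLevel b}, koblitzFactor l

/-- The term `μ(k) / |G_k(E)|`. -/
def cyclicTerm (b : TorsionBasis E) (k : ℕ+) : ℝ :=
  (ArithmeticFunction.moebius k : ℝ) / Nat.card (galImage b k)

/-- The cyclicity constant `C_{E,cyclic}`. -/
def cyclicConst (b : TorsionBasis E) : ℝ :=
  ∑' k : ℕ+, cyclicTerm b k

/-! ### The average constants -/

/-- The Euler factors of `C_r`. -/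
def avgLangTrotterFactor (r : ℤ) (l : Nat.Primes) : ℝ :=
  if ((l : ℕ) : ℤ) ∣ r then 1 + 1 / ((l : ℝ) ^ 2 - 1)
  else 1 - 1 / (((l : ℝ) - 1) * ((l : ℝ) ^ 2 - 1))

/-- The Euler factors of `C_prime`. -/
def avgKoblitzFactor (l : Nat.Primes) : ℝ :=
  1 - ((l : ℝ) ^ 2 - l - 1) / (((l : ℝ) - 1) ^ 3 * ((l : ℝ) + 1))

/-- The Euler factors of `C_cyclic`. -/
def avgCyclicFactor (l : Nat.Primes) : ℝ :=
  1 - 1 / ((l : ℝ) * ((l : ℝ) - 1) ^ 2 * ((l : ℝ) + 1))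

/-- The average Lang–Trotter constant `C_r`. -/
def avgLangTrotterConst (r : ℤ) : ℝ := 2 / Real.pi * ∏' l : Nat.Primes, avgLangTrotterFactor r l

/-- The average Koblitz constant `C_prime`. -/
def avgKoblitzConst : ℝ := ∏' l : Nat.Primes, avgKoblitzFactor l

/-- The average cyclicity constant `C_cyclic`. -/
def avgCyclicConst : ℝ := ∏' l : Nat.Primes, avgCyclicFactor l

/-! ### The discriminant, the level `M_E` and Serre curves -/

theorem exists_squarefree_part (q : ℚ) (hq : q ≠ 0) :
    ∃ d : ℤ, Squarefree d ∧ ∃ t : ℚ, q / d = t ^ 2 := by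
  have hz : q.num * q.den ≠ 0 :=
    mul_ne_zero (Rat.num_ne_zero.mpr hq) (by exact_mod_cast q.den_ne_zero)
  obtain ⟨a, c, -, -, hac, ha⟩ := Nat.sq_mul_squarefree_of_pos (Int.natAbs_pos.mpr hz)
  have hdq : (q.den : ℚ) ≠ 0 := by exact_mod_cast q.den_ne_zero
  have main : ∀ d : ℤ, d ≠ 0 → q.num * q.den = c ^ 2 * d → q / d = (c / q.den : ℚ) ^ 2 := by
    intro d hd h
    have hd' : (d : ℚ) ≠ 0 := by exact_mod_cast hd
    have h2 : (q.num : ℚ) * q.den = c ^ 2 * d := by exact_mod_cast h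
    have h3 : q * q.den = q.num := Rat.mul_den_eq_num q
    rw [div_pow, div_eq_div_iff hd' (pow_ne_zero 2 hdq), ← h2, ← h3]
    ring
  have ha0 : (a : ℤ) ≠ 0 := by exact_mod_cast ha.ne_zero
  have hsf : Squarefree (a : ℤ) := Int.squarefree_natCast.mpr ha
  rcases Int.natAbs_eq (q.num * q.den) with h | h
  · refine ⟨a, hsf, c / q.den, main a ha0 ?_⟩
    rw [h, ← hac]
    push_cast
    ring
  · refine ⟨-a, fun x hx => hsf x ((dvd_neg).mp hx), c / q.den,
      main (-a) (neg_ne_zero.mpr ha0) ?_⟩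
    rw [h, ← hac]
    push_cast
    ring

/-- The square-free part `Δ_sf` of the discriminant `Δ` of `E`: the square-free integer for which
`Δ / Δ_sf` is the square of a rational number. -/
def sfDisc (E : WeierstrassCurve ℚ) [E.IsElliptic] : ℤ :=
  (exists_squarefree_part E.Δ E.isUnit_Δ.ne_zero).choose

theorem sfDisc_squarefree (E : WeierstrassCurve ℚ) [E.IsElliptic] : Squarefree (sfDisc E) :=
  (exists_squarefree_part E.Δ E.isUnit_Δ.ne_zero).choose_spec.1

theorem sfDisc_spec (E : WeierstrassCurve ℚ) [E.IsElliptic] :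
    ∃ t : ℚ, E.Δ / sfDisc E = t ^ 2 :=
  (exists_squarefree_part E.Δ E.isUnit_Δ.ne_zero).choose_spec.2

/-- `M_E`, which is `2 |Δ_sf|` if `Δ_sf ≡ 1 mod 4` and `4 |Δ_sf|` otherwise. -/
def serreLevel (E : WeierstrassCurve ℚ) [E.IsElliptic] : ℕ+ :=
  ⟨if sfDisc E % 4 = 1 then 2 * (sfDisc E).natAbs else 4 * (sfDisc E).natAbs, by
    have h := Int.natAbs_pos.mpr (sfDisc_squarefree E).ne_zero
    split_ifs <;> omega⟩

theorem two_dvd_serreLevel (E : WeierstrassCurve ℚ) [E.IsElliptic] :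
    2 ∣ (serreLevel E : ℕ) := by
  change 2 ∣ (if sfDisc E % 4 = 1 then 2 * (sfDisc E).natAbs else 4 * (sfDisc E).natAbs)
  split_ifs <;> omega

/-- The permutation of the non-zero vectors of `(ℤ/2ℤ)²` induced by an element of `GL₂(ℤ/2ℤ)`;
this is the isomorphism of `GL₂(ℤ/2ℤ)` with the symmetric group on three letters. -/
def permOfGL (g : GL (Fin 2) (ZMod 2)) : Equiv.Perm {v : Fin 2 → ZMod 2 // v ≠ 0} where
  toFun v := ⟨g.1.mulVec v.1, fun h => v.2 (by
    have := congrArg (fun w => (g⁻¹).1.mulVec w) h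
    simpa only [Matrix.mulVec_mulVec, ← Units.val_mul, inv_mul_cancel, Units.val_one,
      Matrix.one_mulVec, Matrix.mulVec_zero] using this)⟩
  invFun v := ⟨(g⁻¹).1.mulVec v.1, fun h => v.2 (by
    have := congrArg (fun w => g.1.mulVec w) h
    simpa only [Matrix.mulVec_mulVec, ← Units.val_mul, mul_inv_cancel, Units.val_one,
      Matrix.one_mulVec, Matrix.mulVec_zero] using this)⟩
  left_inv v := by
    apply Subtype.ext
    simp only [Matrix.mulVec_mulVec, ← Units.val_mul, inv_mul_cancel, Units.val_one,
      Matrix.one_mulVec]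
  right_inv v := by
    apply Subtype.ext
    simp only [Matrix.mulVec_mulVec, ← Units.val_mul, mul_inv_cancel, Units.val_one,
      Matrix.one_mulVec]

/-- The character `ε`: reduction modulo `2` followed by the signature. -/
def epsilon {M : ℕ+} (h : 2 ∣ (M : ℕ)) (g : GL (Fin 2) (ZMod M)) : ℤ :=
  Equiv.Perm.sign (permOfGL (Matrix.GeneralLinearGroup.map (ZMod.castHom h (ZMod 2)) g))

/-- The kernel of `ε(·) (Δ_sf / det(·))` on `GL₂(ℤ/M_E ℤ)`. The symbol is evaluated at the least
positive integer that represents the determinant; that integer is odd, because `M_E` is even, and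
coprime to `Δ_sf`, so that the symbol is a Jacobi symbol. It is trivial if `Δ_sf = 1`. -/
def serreKernel (E : WeierstrassCurve ℚ) [E.IsElliptic] :
    Set (GL (Fin 2) (ZMod (serreLevel E))) :=
  {g | epsilon (two_dvd_serreLevel E) g * jacobiSym (sfDisc E) (Matrix.det g.1).val = 1}

/-- The index two subgroup `H_E` of `GL₂(Ẑ)` that contains the image of `φ_E`. -/
def serreSubgroup (E : WeierstrassCurve ℚ) [E.IsElliptic] : Set (GL (Fin 2) ZHat) :=
  reduction (serreLevel E) ⁻¹' serreKernel E

/-- `E` is a Serre curve if `φ_E(G_ℚ) = H_E`. As `H_E` is normal in `GL₂(Ẑ)`, it does not matter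
with respect to which basis `φ_E` is formed. -/
def IsSerreCurve (E : WeierstrassCurve ℚ) [E.IsElliptic] : Prop :=
  ∃ b : TorsionBasis E, Set.range (adelicRep b) = serreSubgroup E

/-! ### The notation of the explicit formulas, as functions of `d = Δ_sf` -/

/-- The odd positive integer `W = |d| / (d, 2)`. -/
def oddPart (d : ℤ) : ℕ := d.natAbs / Int.gcd d 2

/-- The exponent `k`, which is `1`, `2`, `3` for `d` congruent to `1`, `3`, `2` modulo `4`. -/
def twoExp (d : ℤ) : ℕ := if d % 4 = 1 then 1 else if d % 4 = 3 then 2 else 3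

/-- `χ₄(-d / 2)`, where `χ₄(x) = 1` if `x` is not an integer. -/
def chiFour (d : ℤ) : ℤ := if 2 ∣ d then ZMod.χ₄ ((-d / 2 : ℤ) : ZMod 4) else 1

/-- The sign `δ(d, r)`, used when `2 ^ (k - 1)` divides `r`. -/
def deltaSign (d r : ℤ) : ℤ :=
  (((-1 : ℤˣ) ^ ((ArithmeticFunction.cardDistinctFactors
      (oddPart d / Nat.gcd (oddPart d) r.natAbs) : ℤ) +
    ((oddPart d : ℤ) + 1) / 2 + r / 2 ^ (twoExp d - 1)) : ℤˣ) : ℤ) * chiFour d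

end SerreCurve

end

open scoped WeierstrassCurve.Affine

noncomputable section

set_option linter.unusedSectionVars false

namespace SerreCurve

/-! ### Character sums over `2 × 2` matrices with entries in a finite field -/

section FieldSums

variable {F : Type*} [Field F] [Fintype F] [DecidableEq F] (χ : MulChar F ℤ)

/-! Write `d` for the square-free part of the discriminant, `M` for M_E and ψ = ε(·)(d/det(·)), a
character of GL₂(ℤ/Mℤ) with values ±1. For a Serre curve everything follows from two facts: the
conductor of ψ is exactly `M`, and ψ is a product of local characters.

Conductor (`exists_psi_eq_neg_one`): if `M` does not divide `n`, some matrix over `ZHat` is trivial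
modulo `n` but has ψ = -1. Since reduction from GL₂(`ZHat`) is surjective, G_n(E) is then all of
GL₂(ℤ/nℤ) (`galImage_eq_top`), while for `M ∣ n` it is the kernel of ψ, of index two
(`galImage_eq_ker`). In particular the minimal level is `M` (`minLevel_eq`).

Lang–Trotter and Koblitz: the indicator function of ker ψ is (1 + ψ)/2. So the proportion of
elements of G_M(E) with a given property is the proportion in GL₂(ℤ/Mℤ) times 1 + S/T, where T
counts the matrices with the property and S sums ψ over them. The first factor completes the Euler
product to the average constant. By reciprocity (d/m) = χ(m)(m/W) for odd m, with χ a character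
modulo the power of two q and M = qW. Hence ψ splits along M = qW and its Jacobi part splits over
the primes of W (`Splitting.psi_eq`), and S is a product of local sums. At odd primes these are
character sums over a finite field, easy because the quadratic character sums to zero; modulo 2, 4
and 8 they are finite computations.

Cyclicity: halving |G_n(E)| for `M ∣ n` doubles those terms, so the series is the one for GL₂ plus
its part over the multiples of `M`. Since μ(Mk) = 0 unless k is prime to `M`, that part is the term
at `M` times an Euler product over the primes not dividing `M` (`moebiusTerm_mul_tsum`). -/

theorem sum_char_sub_mul {t u : F} (hu : u ≠ 0) : ∑ c, χ (t - u * c) = ∑ x, χ x := by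
  refine Fintype.sum_bijective (fun c => t - u * c) ?_ _ _ (fun _ => rfl)
  refine (Finite.injective_iff_bijective).mp fun c c' h => ?_
  exact mul_left_cancel₀ hu (sub_right_injective h)

/-- For b = 0 every c contributes χ(t); for b ≠ 0 the map c ↦ t - bc is a bijection, so the inner
sum is the full character sum. -/
theorem sum_sum_char_sub_mul (t : F) :
    ∑ b, ∑ c, χ (t - b * c) =
      Fintype.card F * χ t + (Fintype.card F - 1) * ∑ x, χ x := by
  rw [← Finset.add_sum_erase _ _ (Finset.mem_univ (0 : F)),
    Finset.sum_congr rfl fun b hb => sum_char_sub_mul χ (t := t) (Finset.ne_of_mem_erase hb)]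
  simp [Finset.card_erase_of_mem, Nat.cast_sub Fintype.card_pos]

theorem sum_char_mul_sub (hχ : ∀ x, x ≠ 0 → χ x ^ 2 = 1) (r : F) :
    ∑ a, χ (a * (r - a)) =
      if r = 0 then χ (-1) * (Fintype.card F - 1) else ∑ x, χ x - χ (-1) := by
  split_ifs with hr
  · subst hr
    rw [← Finset.add_sum_erase _ _ (Finset.mem_univ (0 : F)),
      Finset.sum_congr rfl (g := fun _ => χ (-1))]
    · simp [Finset.card_erase_of_mem, Nat.cast_sub Fintype.card_pos, mul_comm, MulChar.map_zero]
    · intro a ha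
      rw [show a * (0 - a) = -1 * a ^ 2 by ring, map_mul, map_pow,
        hχ a (Finset.ne_of_mem_erase ha), mul_one]
  · have h1 : ∑ a, χ (a * (r - a)) = ∑ a ∈ Finset.univ.erase (0 : F), χ (r * a⁻¹ - 1) := by
      rw [← Finset.add_sum_erase _ _ (Finset.mem_univ (0 : F))]
      simp only [zero_mul, MulChar.map_zero, zero_add]
      refine Finset.sum_congr rfl fun a ha => ?_
      have ha := Finset.ne_of_mem_erase ha
      rw [show a * (r - a) = a ^ 2 * (r * a⁻¹ - 1) by field_simp, map_mul, map_pow, hχ a ha,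
        one_mul]
    -- With the convention 0⁻¹ = 0 the map a ↦ r a⁻¹ - 1 is a permutation of all of F. It sends 0 to
    -- -1, which accounts for the subtracted χ(-1).
    have h2 : ∑ a, χ (r * a⁻¹ - 1) = ∑ x, χ x := by
      refine Fintype.sum_bijective (fun a => r * a⁻¹ - 1) ?_ _ _ (fun _ => rfl)
      refine (Finite.injective_iff_bijective).mp fun c c' h => ?_
      exact inv_injective (mul_left_cancel₀ hr (sub_left_injective h))
    rw [h1, ← h2, ← Finset.add_sum_erase _ _ (Finset.mem_univ (0 : F))]
    simp

/-- The sum of χ(det) over the matrices of trace r, whose lower right entry is forced to be r - a.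
-/
theorem sum_trace_char (hχ : ∀ x, x ≠ 0 → χ x ^ 2 = 1) (r : F) :
    ∑ a, ∑ b, ∑ c, χ (a * (r - a) - b * c) =
      Fintype.card F * (if r = 0 then χ (-1) * (Fintype.card F - 1) else ∑ x, χ x - χ (-1)) +
        Fintype.card F * ((Fintype.card F - 1) * ∑ x, χ x) := by
  simp_rw [sum_sum_char_sub_mul, Finset.sum_add_distrib, ← Finset.mul_sum,
    sum_char_mul_sub χ hχ]
  simp [mul_left_comm]

theorem sum_sum_mul_eq_ite (t : F) :
    ∑ b : F, ∑ c : F, (if b * c = t then (1 : ℤ) else 0) =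
      (if t = 0 then (Fintype.card F : ℤ) else 0) + (Fintype.card F - 1) := by
  have h : ∀ b ∈ Finset.univ.erase (0 : F),
      ∑ c : F, (if b * c = t then (1 : ℤ) else 0) = 1 := by
    intro b hb
    have hb := Finset.ne_of_mem_erase hb
    simp_rw [show ∀ c, (b * c = t) ↔ (t / b = c) from fun c => by
      rw [div_eq_iff hb, mul_comm, eq_comm]]
    simp
  rw [← Finset.add_sum_erase _ _ (Finset.mem_univ (0 : F)), Finset.sum_congr rfl h]
  simp [Finset.card_erase_of_mem, Nat.cast_sub Fintype.card_pos, eq_comm (a := (0 : F))]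

theorem sum_det_char :
    ∑ a, ∑ b, ∑ c, ∑ e, χ (a * e - b * c) =
      Fintype.card F * (∑ x, χ x) ^ 2 +
        (Fintype.card F : ℤ) ^ 2 * ((Fintype.card F - 1) * ∑ x, χ x) := by
  have : ∀ a, ∑ b, ∑ c, ∑ e, χ (a * e - b * c) = ∑ e, ∑ b, ∑ c, χ (a * e - b * c) := fun a => by
    simp_rw [Finset.sum_comm (s := Finset.univ) (t := Finset.univ)
      (f := fun c e => χ (a * e - _ * c))]
    rw [Finset.sum_comm]
  simp_rw [this, sum_sum_char_sub_mul, Finset.sum_add_distrib, ← Finset.mul_sum, map_mul,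
    ← Finset.mul_sum, ← Finset.sum_mul]
  simp only [Finset.sum_const, Finset.card_univ, nsmul_eq_mul]
  ring

theorem sum_char_add (u : F) : ∑ e, χ (u + e) = ∑ x, χ x :=
  Fintype.sum_equiv (Equiv.addLeft u) _ _ fun _ => rfl

/-- The sum of χ(det A) over the matrices with eigenvalue 1. For these det A = tr A - 1 depends on
the diagonal only, so b and c enter only through the number of solutions of bc = (1 - a)(1 - e). -/
theorem sum_fixed_vector_char :
    ∑ a, ∑ b, ∑ c, ∑ e,
        (if (1 - a) * (1 - e) - b * c = 0 then χ (a * e - b * c) else 0) =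
      (Fintype.card F - 1) * (Fintype.card F * ∑ x, χ x) +
        Fintype.card F * (2 * ∑ x, χ x - 1) := by
  have h1 : ∀ a, ∑ b, ∑ c, ∑ e,
      (if (1 - a) * (1 - e) - b * c = 0 then χ (a * e - b * c) else 0) =
      ∑ e, ((if (1 - a) * (1 - e) = 0 then (Fintype.card F : ℤ) else 0) +
        (Fintype.card F - 1)) * χ (a - 1 + e) := fun a => by
    rw [Finset.sum_congr rfl fun b _ => Finset.sum_comm, Finset.sum_comm]
    refine Finset.sum_congr rfl fun e _ => ?_
    rw [← sum_sum_mul_eq_ite, Finset.sum_mul]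
    refine Finset.sum_congr rfl fun b _ => ?_
    rw [Finset.sum_mul]
    refine Finset.sum_congr rfl fun c _ => ?_
    by_cases h : b * c = (1 - a) * (1 - e)
    · rw [if_pos (by rw [h, sub_self]), if_pos h, h, one_mul]
      congr 1
      ring
    · rw [if_neg fun h' => h (sub_eq_zero.mp h').symm, if_neg h, zero_mul]
  have h2 : ∑ a, ∑ e, (if (1 - a) * (1 - e) = 0 then (Fintype.card F : ℤ) else 0) *
      χ (a - 1 + e) = Fintype.card F * (2 * ∑ x, χ x - 1) := by
    -- Inclusion–exclusion on a = 1 or e = 1; the overlap a = e = 1 contributes χ(1) = 1.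
    have : ∀ a e : F, (if (1 - a) * (1 - e) = 0 then (Fintype.card F : ℤ) else 0) *
        χ (a - 1 + e) = Fintype.card F * ((if 1 = a then χ e else 0) +
          (if 1 = e then χ a else 0) - if 1 = a then if 1 = e then 1 else 0 else 0) := by
      intro a e
      by_cases ha : 1 = a <;> by_cases he : 1 = e
      · subst ha; subst he; simp
      · subst ha; simp [he]
      · subst he; simp [ha]
      · simp [ha, he, sub_eq_zero]
    simp_rw [this, ← Finset.mul_sum, Finset.sum_sub_distrib, Finset.sum_add_distrib]
    simp [Finset.sum_ite_irrel]
    ring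
  simp_rw [h1, add_mul, Finset.sum_add_distrib, h2, ← Finset.mul_sum, sum_char_add]
  simp
  ring

end FieldSums
end SerreCurve

namespace SerreCurve

/-! ### Sums over `GL₂(ℤ/nℤ)` and the Chinese remainder theorem -/

/-- The `2 × 2` matrices over `ℤ/nℤ`. -/
abbrev Mat (n : ℕ) := Matrix (Fin 2) (Fin 2) (ZMod n)

/-- Reduction of matrices. -/
def reduceMat {m n : ℕ} (h : m ∣ n) (A : Mat n) : Mat m := A.map (ZMod.castHom h (ZMod m))

theorem det_reduceMat {m n : ℕ} (h : m ∣ n) (A : Mat n) :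
    (reduceMat h A).det = ZMod.castHom h (ZMod m) A.det :=
  ((ZMod.castHom h (ZMod m)).map_det A).symm

theorem trace_reduceMat {m n : ℕ} (h : m ∣ n) (A : Mat n) :
    (reduceMat h A).trace = ZMod.castHom h (ZMod m) A.trace := by
  rw [Matrix.trace_fin_two, Matrix.trace_fin_two, map_add]
  rfl

theorem reduceMat_one_sub {m n : ℕ} (h : m ∣ n) (A : Mat n) :
    reduceMat h (1 - A) = 1 - reduceMat h A := by
  have := map_sub ((ZMod.castHom h (ZMod m)).mapMatrix) (1 : Mat n) A
  rwa [map_one] at this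

theorem reduceMat_reduceMat {k m n : ℕ} (h : k ∣ m) (h' : m ∣ n) (A : Mat n) :
    reduceMat h (reduceMat h' A) = reduceMat (h.trans h') A := by
  ext i j
  exact DFunLike.congr_fun (ZMod.castHom_comp h h') (A i j)

theorem isUnit_det {n : ℕ} (g : GL (Fin 2) (ZMod n)) : IsUnit g.1.det :=
  (Matrix.isUnit_iff_isUnit_det g.1).mp ⟨g, rfl⟩

/-- The sum of `f` over `GL₂(ℤ/nℤ)`. -/
def glSum (n : ℕ) (f : Mat n → ℤ) : ℤ := ∑ᶠ g : GL (Fin 2) (ZMod n), f g.1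

section CRT

variable {m n : ℕ} (h : m.Coprime n)
include h

theorem crt_eq_iff (x y : ZMod (m * n)) :
    x = y ↔ ZMod.castHom (Dvd.intro n rfl) (ZMod m) x = ZMod.castHom (Dvd.intro n rfl) (ZMod m) y ∧
      ZMod.castHom (Dvd.intro_left m rfl) (ZMod n) x =
        ZMod.castHom (Dvd.intro_left m rfl) (ZMod n) y := by
  -- A ring homomorphism out of ℤ/mnℤ is unique, so the reductions are the two components of the
  -- Chinese remainder isomorphism.
  have h1 : ZMod.castHom (Dvd.intro n rfl) (ZMod m) =
      (RingHom.fst _ _).comp (ZMod.chineseRemainder h : ZMod (m * n) →+* ZMod m × ZMod n) :=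
    Subsingleton.elim _ _
  have h2 : ZMod.castHom (Dvd.intro_left m rfl) (ZMod n) =
      (RingHom.snd _ _).comp (ZMod.chineseRemainder h : ZMod (m * n) →+* ZMod m × ZMod n) :=
    Subsingleton.elim _ _
  rw [h1, h2, ← (ZMod.chineseRemainder h).injective.eq_iff, Prod.ext_iff]
  rfl

theorem crt_exists (x : ZMod m) (y : ZMod n) :
    ∃ z : ZMod (m * n), ZMod.castHom (Dvd.intro n rfl) (ZMod m) z = x ∧
      ZMod.castHom (Dvd.intro_left m rfl) (ZMod n) z = y := by
  have h1 : ZMod.castHom (Dvd.intro n rfl) (ZMod m) =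
      (RingHom.fst _ _).comp (ZMod.chineseRemainder h : ZMod (m * n) →+* ZMod m × ZMod n) :=
    Subsingleton.elim _ _
  have h2 : ZMod.castHom (Dvd.intro_left m rfl) (ZMod n) =
      (RingHom.snd _ _).comp (ZMod.chineseRemainder h : ZMod (m * n) →+* ZMod m × ZMod n) :=
    Subsingleton.elim _ _
  refine ⟨(ZMod.chineseRemainder h).symm (x, y), ?_, ?_⟩
  · rw [h1]; simp
  · rw [h2]; simp

theorem crt_isUnit_iff (x : ZMod (m * n)) :
    IsUnit x ↔ IsUnit (ZMod.castHom (Dvd.intro n rfl) (ZMod m) x) ∧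
      IsUnit (ZMod.castHom (Dvd.intro_left m rfl) (ZMod n) x) := by
  refine ⟨fun hx => ⟨hx.map _, hx.map _⟩, fun ⟨h1, h2⟩ => ?_⟩
  obtain ⟨y1, hy1⟩ := h1.exists_right_inv
  obtain ⟨y2, hy2⟩ := h2.exists_right_inv
  obtain ⟨y, rfl, rfl⟩ := crt_exists h y1 y2
  refine IsUnit.of_mul_eq_one y ((crt_eq_iff h _ _).mpr ⟨?_, ?_⟩)
  · rw [map_mul, hy1, map_one]
  · rw [map_mul, hy2, map_one]

theorem crt_gl_bijective :
    Function.Bijective fun g : GL (Fin 2) (ZMod (m * n)) =>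
      (Matrix.GeneralLinearGroup.map (ZMod.castHom (Dvd.intro n rfl) (ZMod m)) g,
        Matrix.GeneralLinearGroup.map (ZMod.castHom (Dvd.intro_left m rfl) (ZMod n)) g) := by
  constructor
  · intro g g' hg
    obtain ⟨h1, h2⟩ := Prod.ext_iff.mp hg
    ext i j
    refine (crt_eq_iff h _ _).mpr ⟨?_, ?_⟩
    · exact (Matrix.GeneralLinearGroup.ext_iff _ _).mp h1 i j
    · exact (Matrix.GeneralLinearGroup.ext_iff _ _).mp h2 i j
  · rintro ⟨u, v⟩
    choose z hz1 hz2 using fun i j => crt_exists h (u.1 i j) (v.1 i j)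
    have hd1 : reduceMat (Dvd.intro n rfl) (Matrix.of z) = u.1 := by
      ext i j; exact hz1 i j
    have hd2 : reduceMat (Dvd.intro_left m rfl) (Matrix.of z) = v.1 := by
      ext i j; exact hz2 i j
    have hu : IsUnit (Matrix.of z).det := by
      rw [crt_isUnit_iff h, ← det_reduceMat, ← det_reduceMat, hd1, hd2]
      exact ⟨isUnit_det u, isUnit_det v⟩
    exact ⟨Matrix.GeneralLinearGroup.mk'' _ hu, Prod.ext (Units.ext hd1) (Units.ext hd2)⟩

theorem glSum_mul [NeZero m] [NeZero n] (f : Mat m → ℤ) (f' : Mat n → ℤ) :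
    glSum (m * n) (fun A => f (reduceMat (Dvd.intro n rfl) A) *
      f' (reduceMat (Dvd.intro_left m rfl) A)) = glSum m f * glSum n f' := by
  refine (finsum_eq_of_bijective _ (crt_gl_bijective h)
    (g := fun p => f p.1.1 * f' p.2.1) (fun _ => rfl)).trans ?_
  rw [glSum, glSum, finsum_eq_sum_of_fintype, finsum_eq_sum_of_fintype, finsum_eq_sum_of_fintype,
    Fintype.sum_prod_type, Finset.sum_mul_sum]

end CRT

/-- A family of functions that is compatible with the Chinese remainder theorem. -/
structure IsLocal (F : ∀ n, Mat n → ℤ) : Prop where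
  one (A : Mat 1) : F 1 A = 1
  mul (m n : ℕ) [NeZero m] [NeZero n] (h : m.Coprime n) (A : Mat (m * n)) :
    F (m * n) A = F m (reduceMat (Dvd.intro n rfl) A) * F n (reduceMat (Dvd.intro_left m rfl) A)

theorem IsLocal.const_one : IsLocal fun _ _ => 1 := ⟨fun _ => rfl, fun _ _ _ _ _ _ => rfl⟩

theorem IsLocal.pointwise_mul {F G : ∀ n, Mat n → ℤ} (hF : IsLocal F) (hG : IsLocal G) :
    IsLocal fun n A => F n A * G n A :=
  ⟨fun A => by rw [hF.one, hG.one, one_mul], fun m n _ _ h A => by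
    rw [hF.mul m n h, hG.mul m n h]; ring⟩

/-- The indicator function of the matrices of trace `r`. -/
def traceInd (r : ℤ) (n : ℕ) (A : Mat n) : ℤ := if A.trace = (r : ZMod n) then 1 else 0

open Classical in
/-- The indicator function of the matrices `A` for which `det (1 - A)` is a unit. -/
def koblitzInd (n : ℕ) (A : Mat n) : ℤ := if IsUnit (1 - A).det then 1 else 0

/-- The Jacobi symbol with the modulus as denominator. -/
def jacobiMod (n : ℕ) (x : ZMod n) : ℤ := jacobiSym x.val n

theorem isLocal_traceInd (r : ℤ) : IsLocal (traceInd r) :=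
  ⟨fun A => if_pos (Subsingleton.elim _ _), fun m n _ _ h A => by
    simp only [traceInd, crt_eq_iff h, trace_reduceMat, map_intCast, ite_and]
    split_ifs <;> rfl⟩

theorem isLocal_koblitzInd : IsLocal koblitzInd :=
  ⟨fun A => if_pos (isUnit_of_subsingleton _), fun m n _ _ h A => by
    simp only [koblitzInd, crt_isUnit_iff h, ← det_reduceMat, reduceMat_one_sub, ite_and]
    split_ifs <;> rfl⟩

theorem jacobiMod_castHom {m n : ℕ} [NeZero n] (h : m ∣ n) (x : ZMod n) :
    jacobiMod m (ZMod.castHom h (ZMod m) x) = jacobiSym x.val m := by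
  refine jacobiSym.mod_left' ?_
  have : NeZero m := ⟨fun hm => NeZero.ne n (by simpa [hm] using h)⟩
  rw [ZMod.castHom_apply, ZMod.cast_eq_val, ZMod.val_natCast]
  push_cast
  exact Int.emod_emod _ _

theorem jacobiMod_natCast (n : ℕ) [NeZero n] (x : ℕ) :
    jacobiMod n (x : ZMod n) = jacobiSym x n := by
  refine jacobiSym.mod_left' ?_
  rw [ZMod.val_natCast]
  push_cast
  exact Int.emod_emod _ _

theorem jacobiMod_mul (n : ℕ) [NeZero n] (x y : ZMod n) :
    jacobiMod n (x * y) = jacobiMod n x * jacobiMod n y := by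
  conv_lhs => rw [← ZMod.natCast_zmod_val x, ← ZMod.natCast_zmod_val y, ← Nat.cast_mul,
    jacobiMod_natCast]
  rw [jacobiMod, jacobiMod, ← jacobiSym.mul_left, Nat.cast_mul]

theorem isLocal_jacobiMod : IsLocal fun n A => jacobiMod n A.det :=
  ⟨fun A => jacobiSym.one_right _, fun m n _ _ h A => by
    simp only [det_reduceMat, jacobiMod_castHom]
    exact jacobiSym.mul_right _ _ _⟩

theorem glSum_one_modulus (f : Mat 1 → ℤ) (hf : ∀ A, f A = 1) : glSum 1 f = 1 := by
  have : Unique (GL (Fin 2) (ZMod 1)) :=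
    ⟨⟨1⟩, fun a => Units.ext (Matrix.ext fun _ _ => Subsingleton.elim _ _)⟩
  rw [glSum, finsum_unique, hf]

theorem IsLocal.glSum_eq_prod {F : ∀ n, Mat n → ℤ} (hF : IsLocal F) {W : ℕ}
    (hW : Squarefree W) : glSum W (F W) = ∏ p ∈ W.primeFactors, glSum p (F p) := by
  have h1 : glSum 1 (F 1) = 1 := glSum_one_modulus _ hF.one
  rw [Nat.multiplicative_factorization (fun n => glSum n (F n)) ?_ h1 hW.ne_zero,
    Finsupp.prod, Nat.support_factorization]
  · refine Finset.prod_congr rfl fun p hp => ?_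
    have hp' := Nat.prime_of_mem_primeFactors hp
    rw [(hW.natFactorization_le_one p).antisymm
      ((hp'.factorization_pos_of_dvd hW.ne_zero (Nat.dvd_of_mem_primeFactors hp))), pow_one]
  · intro m n h
    -- Modulus 0 would mean GL₂(ℤ), but 0 is coprime only to 1, and the value at 1 is 1.
    rcases Nat.eq_zero_or_pos m with rfl | hm
    · rw [Nat.coprime_zero_left] at h
      subst h
      simp [h1]
    rcases Nat.eq_zero_or_pos n with rfl | hn
    · rw [Nat.coprime_zero_right] at h
      subst h
      simp [h1]
    have : NeZero m := ⟨hm.ne'⟩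
    have : NeZero n := ⟨hn.ne'⟩
    rw [← glSum_mul h]
    exact congrArg _ (funext (hF.mul m n h))

/-! ### Sums over matrices in terms of their entries -/

section Entries

variable {R : Type*} [CommRing R] [Fintype R] [DecidableEq R]

theorem sum_matrix_fin_two (f : Matrix (Fin 2) (Fin 2) R → ℤ) :
    ∑ A, f A = ∑ a, ∑ b, ∑ c, ∑ e, f !![a, b; c, e] := by
  have h : Function.Bijective
      (fun A : Matrix (Fin 2) (Fin 2) R => (A 0 0, A 0 1, A 1 0, A 1 1)) := by
    refine ⟨fun A B h => ?_, fun ⟨a, b, c, e⟩ => ⟨!![a, b; c, e], rfl⟩⟩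
    simp only [Prod.mk.injEq] at h
    ext i j
    fin_cases i <;> fin_cases j <;> simp [h]
  simp_rw [← Fintype.sum_prod_type']
  exact Fintype.sum_bijective _ h _ _ fun A => congrArg f (Matrix.eta_fin_two A)

open Classical in
theorem sum_gl_eq (f : Matrix (Fin 2) (Fin 2) R → ℤ) :
    ∑ g : GL (Fin 2) R, f g.1 =
      ∑ a, ∑ b, ∑ c, ∑ e, if IsUnit (a * e - b * c) then f !![a, b; c, e] else 0 := by
  have := sum_matrix_fin_two fun A : Matrix (Fin 2) (Fin 2) R => if IsUnit A.det then f A else 0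
  simp only [Matrix.det_fin_two_of] at this
  rw [← this, ← Finset.sum_filter]
  refine Finset.sum_bij (fun g _ => g.1) ?_ ?_ ?_ ?_
  · intro g _
    exact Finset.mem_filter.mpr ⟨Finset.mem_univ _, (Matrix.isUnit_iff_isUnit_det g.1).mp ⟨g, rfl⟩⟩
  · intro g _ g' _ h
    exact Units.ext h
  · intro A hA
    obtain ⟨u, hu⟩ := (Matrix.isUnit_iff_isUnit_det A).mpr (Finset.mem_filter.mp hA).2
    exact ⟨u, Finset.mem_univ _, hu⟩
  · intro _ _
    rfl

end Entries

open Classical in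
theorem glSum_eq (n : ℕ) [NeZero n] (f : Mat n → ℤ) :
    glSum n f =
      ∑ a, ∑ b, ∑ c, ∑ e, if IsUnit (a * e - b * c) then f !![a, b; c, e] else 0 := by
  rw [glSum, finsum_eq_sum_of_fintype, sum_gl_eq]

open Classical in
theorem glSum_traceInd_mul (r : ℤ) (n : ℕ) [NeZero n] (f : Mat n → ℤ) :
    glSum n (fun A => traceInd r n A * f A) =
      ∑ a : ZMod n, ∑ b, ∑ c, if IsUnit (a * (r - a) - b * c) then f !![a, b; c, r - a] else 0 := by
  rw [glSum_eq]
  refine Finset.sum_congr rfl fun a _ => Finset.sum_congr rfl fun b _ =>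
    Finset.sum_congr rfl fun c _ => ?_
  rw [Finset.sum_eq_single ((r : ZMod n) - a)]
  · simp [traceInd, Matrix.trace_fin_two]
  · intro e _ he
    have : (!![a, b; c, e] : Mat n).trace ≠ r := by
      rw [Matrix.trace_fin_two_of]
      exact fun h => he (eq_sub_of_add_eq' h)
    rw [traceInd, if_neg this, zero_mul, ite_self]
  · simp

end SerreCurve

namespace SerreCurve

/-! ### The sums at an odd prime -/

section Prime

variable (p : ℕ) [Fact p.Prime]

theorem jacobiMod_prime (x : ZMod p) : jacobiMod p x = quadraticChar (ZMod p) x := by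
  rw [jacobiMod, ← jacobiSym.legendreSym.to_jacobiSym, legendreSym]
  simp

theorem sum_trivial_mulChar : ∑ x, (1 : MulChar (ZMod p) ℤ) x = p - 1 := by
  rw [MulChar.sum_one_eq_card_units, ZMod.card_units, Nat.cast_sub (Fact.out : p.Prime).one_le,
    Nat.cast_one]

theorem trivial_mulChar_sq (x : ZMod p) (hx : x ≠ 0) : (1 : MulChar (ZMod p) ℤ) x ^ 2 = 1 := by
  rw [MulChar.one_apply hx.isUnit, one_pow]

/-- A multiplicative character vanishes off the units, so the restriction to invertible matrices can
be dropped and the entrywise sum over the field applies. -/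
theorem glSum_det_char (χ : MulChar (ZMod p) ℤ) :
    glSum p (fun A => χ A.det) = p * (∑ x, χ x) ^ 2 + (p : ℤ) ^ 2 * ((p - 1) * ∑ x, χ x) := by
  have := sum_det_char χ
  rw [ZMod.card] at this
  rw [glSum_eq, ← this]
  simp_rw [Matrix.det_fin_two_of]
  congr! with a _ b _ c _ e _
  split_ifs with h
  · rfl
  · exact (χ.map_nonunit h).symm

theorem glSum_traceInd_char (χ : MulChar (ZMod p) ℤ) (hχ : ∀ x, x ≠ 0 → χ x ^ 2 = 1) (r : ℤ) :
    glSum p (fun A => traceInd r p A * χ A.det) =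
      p * (if (r : ZMod p) = 0 then χ (-1) * (p - 1) else ∑ x, χ x - χ (-1)) +
        p * ((p - 1) * ∑ x, χ x) := by
  have := sum_trace_char χ hχ (r : ZMod p)
  rw [ZMod.card] at this
  rw [glSum_traceInd_mul, ← this]
  simp_rw [Matrix.det_fin_two_of]
  congr! with a _ b _ c _
  split_ifs with h
  · rfl
  · exact (χ.map_nonunit h).symm

/-- Complementary counting: the sum over all matrices minus the sum over those with det(1 - A) = 0.
-/
theorem glSum_koblitzInd_char (χ : MulChar (ZMod p) ℤ) :
    glSum p (fun A => koblitzInd p A * χ A.det) =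
      p * (∑ x, χ x) ^ 2 + p * (∑ x, χ x) * (p ^ 2 - 2 * p - 1) + p := by
  have h1 := sum_det_char χ
  have h2 := sum_fixed_vector_char χ
  rw [ZMod.card] at h1 h2
  have h3 : glSum p (fun A => koblitzInd p A * χ A.det) = p * (∑ x, χ x) ^ 2 +
      (p : ℤ) ^ 2 * ((p - 1) * ∑ x, χ x) - ((p - 1) * (p * ∑ x, χ x) +
        p * (2 * ∑ x, χ x - 1)) := by
    rw [← h1, ← h2, glSum_eq]
    simp_rw [← Finset.sum_sub_distrib]
    refine Finset.sum_congr rfl fun a _ => Finset.sum_congr rfl fun b _ =>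
      Finset.sum_congr rfl fun c _ => Finset.sum_congr rfl fun e _ => ?_
    have hdet : (1 - !![a, b; c, e] : Mat p).det = (1 - a) * (1 - e) - b * c := by
      simp [Matrix.det_fin_two]
    simp only [koblitzInd, hdet, Matrix.det_fin_two_of, isUnit_iff_ne_zero]
    by_cases h : a * e - b * c = 0 <;> by_cases h' : (1 - a) * (1 - e) - b * c = 0 <;>
      simp [h, h', MulChar.map_zero]
  rw [h3]
  ring

theorem glSum_congr {n : ℕ} {f f' : Mat n → ℤ} (h : ∀ A : Mat n, IsUnit A.det → f A = f' A) :
    glSum n f = glSum n f' :=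
  finsum_congr fun g => h _ (isUnit_det g)

/-- The trivial character, with sum p - 1, turns the general character formula into a plain count;
the two counts that follow arise in the same way. -/
theorem glSum_one_prime : glSum p (fun _ => 1) = p * (p - 1) ^ 2 * (p + 1) := by
  have := glSum_det_char p 1
  rw [sum_trivial_mulChar] at this
  rw [glSum_congr (f' := fun A => (1 : MulChar (ZMod p) ℤ) A.det)
    fun A hA => (MulChar.one_apply hA).symm, this]
  ring

theorem glSum_traceInd_prime (r : ℤ) : glSum p (traceInd r p) =
    if (r : ZMod p) = 0 then (p : ℤ) ^ 3 - p ^ 2 else (p : ℤ) ^ 3 - p ^ 2 - p := by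
  have := glSum_traceInd_char p 1 (trivial_mulChar_sq p) r
  rw [sum_trivial_mulChar, MulChar.one_apply (by simp)] at this
  rw [glSum_congr (f' := fun A => traceInd r p A * (1 : MulChar (ZMod p) ℤ) A.det)
    fun A hA => by rw [MulChar.one_apply hA, mul_one], this]
  split_ifs <;> ring

theorem glSum_koblitzInd_prime :
    glSum p (koblitzInd p) = p * ((p : ℤ) ^ 3 - 2 * p ^ 2 - p + 3) := by
  have := glSum_koblitzInd_char p 1
  rw [sum_trivial_mulChar] at this
  rw [glSum_congr (f' := fun A => koblitzInd p A * (1 : MulChar (ZMod p) ℤ) A.det)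
    fun A hA => by rw [MulChar.one_apply hA, mul_one], this]
  ring

theorem sum_quadraticChar (hp : p ≠ 2) : ∑ x, quadraticChar (ZMod p) x = 0 :=
  quadraticChar_sum_zero (by rwa [ZMod.ringChar_zmod_n])

/-- The quadratic character sums to zero, so only the terms with its value at -1 survive, and that
value is χ₄(p). -/
theorem glSum_traceInd_jacobiMod_prime (hp : p ≠ 2) (r : ℤ) :
    glSum p (fun A => traceInd r p A * jacobiMod p A.det) =
      p * (ZMod.χ₄ p * (if (r : ZMod p) = 0 then (p : ℤ) - 1 else -1)) := by
  simp_rw [jacobiMod_prime]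
  rw [glSum_traceInd_char p _ (fun x hx => quadraticChar_sq_one hx), sum_quadraticChar p hp,
    quadraticChar_neg_one (by rwa [ZMod.ringChar_zmod_n]), ZMod.card]
  split_ifs <;> ring

theorem glSum_koblitzInd_jacobiMod_prime (hp : p ≠ 2) :
    glSum p (fun A => koblitzInd p A * jacobiMod p A.det) = p := by
  simp_rw [jacobiMod_prime]
  rw [glSum_koblitzInd_char, sum_quadraticChar p hp]
  ring

end Prime

/-! ### The sums modulo `2`, `4` and `8` -/

/-- The signature of an element of `GL₂(ℤ/2ℤ)`, in terms of its entries. -/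
def signTwo (A : Mat 2) : ℤ :=
  if A 0 0 + A 1 1 = 1 ∨ (A 0 1 = 0 ∧ A 1 0 = 0) then 1 else -1

/-- In GL₂(ℤ/2ℤ) trace 1 means order three; the elements of trace 0 are the identity, which is the
diagonal one, and the three transpositions. -/
theorem sign_permOfGL (g : GL (Fin 2) (ZMod 2)) :
    (Equiv.Perm.sign (permOfGL g) : ℤ) = signTwo g.1 := by
  -- The determinant is 1, so the adjugate is an explicit inverse and the claim becomes a check over
  -- the four entries.
  have key : ∀ a b c e : ZMod 2, ∀ h : a * e - b * c = 1,
      (Equiv.Perm.sign (permOfGL ⟨!![a, b; c, e], !![e, -b; -c, a],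
        by revert a b c e; decide, by revert a b c e; decide⟩) : ℤ) =
          signTwo !![a, b; c, e] := by decide +kernel
  have hd : g.1 0 0 * g.1 1 1 - g.1 0 1 * g.1 1 0 = 1 := by
    have h := isUnit_det g
    rw [Matrix.det_fin_two] at h
    revert h
    generalize g.1 0 0 * g.1 1 1 - g.1 0 1 * g.1 1 0 = x
    rw [isUnit_iff_ne_zero]
    revert x
    decide
  have h := key _ _ _ _ hd
  have hg : g = ⟨!![g.1 0 0, g.1 0 1; g.1 1 0, g.1 1 1],
      !![g.1 1 1, -g.1 0 1; -g.1 1 0, g.1 0 0], by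
        generalize g.1 0 0 = a, g.1 0 1 = b, g.1 1 0 = c, g.1 1 1 = e at hd
        revert a b c e; decide, by
        generalize g.1 0 0 = a, g.1 0 1 = b, g.1 1 0 = c, g.1 1 1 = e at hd
        revert a b c e; decide⟩ := Units.ext (Matrix.eta_fin_two g.1)
  rw [← hg] at h
  rw [h, ← Matrix.eta_fin_two g.1]

theorem isUnit_zmod_two (x : ZMod 2) : IsUnit x ↔ x.val % 2 = 1 := by
  rw [isUnit_iff_exists_inv]; revert x; decide

theorem isUnit_zmod_four (x : ZMod 4) : IsUnit x ↔ x.val % 2 = 1 := by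
  rw [isUnit_iff_exists_inv]; revert x; decide

theorem isUnit_zmod_eight (x : ZMod 8) : IsUnit x ↔ x.val % 2 = 1 := by
  rw [isUnit_iff_exists_inv]; revert x; decide

/-- The data attached to the squarefree integer `d`: the modulus is `q W` with `q = 2 h` a power
of two, `W` is odd, and the Kronecker symbol of `d` is the product of the character `χ` modulo `q`
with the Jacobi symbol modulo `W`. -/
structure Splitting (d : ℤ) (h q W : ℕ) (χ : ZMod q →* ℤ) : Prop where
  h_eq : h = 2 ^ (twoExp d - 1)
  q_eq : q = 2 * h
  W_eq : W = oddPart d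
  W_odd : Odd W
  level : (if d % 4 = 1 then 2 * d.natAbs else 4 * d.natAbs) = q * W
  jacobi (m : ℕ) (hm : Odd m) : jacobiSym d m = χ m * jacobiSym m W
  -- This records that χ does not factor through a smaller even modulus; it is what makes q the
  -- exact 2-part of the conductor of ψ.
  conductor (n : ℕ) (hn : 2 ∣ n) (hqn : ¬ q ∣ n) :
    ∃ u : ℕ, Odd u ∧ u ≡ 1 [MOD n.gcd q] ∧ χ u = -1
  -- Invertibility is decided modulo 2. Each matrix modulo 2 has (q/2)⁴ lifts, and (q/2)³ of them
  -- have a prescribed compatible trace. The counts modulo 2 are 6 in all, 4 or 2 for trace 0 or 1,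
  -- and 2 with det(1 - A) a unit.
  card : 16 * glSum q (fun _ => 1) = q ^ 4 * 6
  traceCount (r : ℤ) : 8 * glSum q (traceInd r q) = q ^ 3 * (if (r : ZMod 2) = 0 then 4 else 2)
  koblitzCount : 16 * glSum q (koblitzInd q) = q ^ 4 * 2
  traceSum (hq : 2 ∣ q) (r : ℤ) :
    glSum q (fun A => traceInd r q A * (signTwo (reduceMat hq A) * χ A.det)) =
      -(q * h) * chiFour d *
        (if (r : ZMod q) = 0 then 1 else if (r : ZMod q) = h then -1 else 0)
  koblitzSum (hq : 2 ∣ q) :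
    glSum q (fun A => koblitzInd q A * (signTwo (reduceMat hq A) * χ A.det)) =
      if d % 4 = 1 then 2 else 0

end SerreCurve

namespace SerreCurve

/-! ### Sums modulo powers of two as computable sums over entries -/

section TwoPower

/-- The indicator function of the odd residue classes modulo an even number. -/
def oddInd {q : ℕ} (x : ZMod q) : ℤ := if x.val % 2 = 1 then 1 else 0

/-- The signature modulo `2` of a matrix with entries modulo an even number. -/
def signEntries {q : ℕ} (a b c e : ZMod q) : ℤ :=
  if (a.val + e.val) % 2 = 1 ∨ (b.val % 2 = 0 ∧ c.val % 2 = 0) then 1 else -1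

variable {q : ℕ} [NeZero q]

theorem signTwo_reduceMat (hq : 2 ∣ q) (a b c e : ZMod q) :
    signTwo (reduceMat hq !![a, b; c, e]) = signEntries a b c e := by
  have h (x : ZMod q) : ZMod.castHom hq (ZMod 2) x = (x.val : ZMod 2) := by
    rw [ZMod.castHom_apply, ZMod.cast_eq_val]
  simp only [signTwo, signEntries, reduceMat, Matrix.map_apply, Matrix.of_apply, Matrix.cons_val',
    Matrix.cons_val_zero, Matrix.cons_val_one, Matrix.cons_val_fin_one, h, ← Nat.cast_add]
  refine if_congr (or_congr ?_ (and_congr ?_ ?_)) rfl rfl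
  · rw [ZMod.natCast_eq_one_iff_odd, Nat.odd_iff]
  · rw [ZMod.natCast_eq_zero_iff_even, Nat.even_iff]
  · rw [ZMod.natCast_eq_zero_iff_even, Nat.even_iff]

variable (hU : ∀ x : ZMod q, IsUnit x ↔ x.val % 2 = 1)
include hU

/-- Units are expressed by the parity of the representative, so that each sum modulo 2, 4 or 8
becomes a closed integer expression that can be evaluated by `decide`. -/
theorem glSum_eq_oddInd (f : Mat q → ℤ) :
    glSum q f = ∑ a, ∑ b, ∑ c, ∑ e, oddInd (a * e - b * c) * f !![a, b; c, e] := by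
  rw [glSum_eq]
  simp only [hU, oddInd, ite_mul, one_mul, zero_mul]

theorem glSum_traceInd_eq_oddInd (r : ℤ) (f : Mat q → ℤ) :
    glSum q (fun A => traceInd r q A * f A) =
      ∑ a : ZMod q, ∑ b, ∑ c, oddInd (a * ((r : ZMod q) - a) - b * c) *
        f !![a, b; c, r - a] := by
  rw [glSum_traceInd_mul]
  simp only [hU, oddInd, ite_mul, one_mul, zero_mul]

theorem koblitzInd_eq_oddInd (a b c e : ZMod q) :
    koblitzInd q !![a, b; c, e] = oddInd ((1 - a) * (1 - e) - b * c) := by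
  have hdet : (1 - !![a, b; c, e] : Mat q).det = (1 - a) * (1 - e) - b * c := by
    simp [Matrix.det_fin_two]
  simp only [koblitzInd, hdet, hU, oddInd]

theorem glSum_one_of_entries {N : ℕ}
    (h : ∑ a : ZMod q, ∑ b : ZMod q, ∑ c : ZMod q, ∑ e : ZMod q, oddInd (a * e - b * c) = N) :
    glSum q (fun _ => 1) = N := by
  rw [glSum_eq_oddInd hU, ← h]
  simp only [mul_one]

theorem glSum_traceInd_of_entries {N : ZMod q → ℤ}
    (h : ∀ r : ZMod q, ∑ a : ZMod q, ∑ b : ZMod q, ∑ c : ZMod q, oddInd (a * (r - a) - b * c) = N r)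
    (r : ℤ) : glSum q (traceInd r q) = N r := by
  have := glSum_traceInd_eq_oddInd hU r fun _ => 1
  simp only [mul_one] at this
  rw [this, h]

theorem glSum_koblitzInd_of_entries {N : ℤ}
    (h : ∑ a : ZMod q, ∑ b : ZMod q, ∑ c : ZMod q, ∑ e : ZMod q,
      oddInd (a * e - b * c) * oddInd ((1 - a) * (1 - e) - b * c) = N) :
    glSum q (koblitzInd q) = N := by
  rw [glSum_eq_oddInd hU, ← h]
  simp only [koblitzInd_eq_oddInd hU]

theorem glSum_traceInd_sign_of_entries {χ : ZMod q →* ℤ} {N : ZMod q → ℤ}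
    (h : ∀ r : ZMod q, ∑ a : ZMod q, ∑ b : ZMod q, ∑ c : ZMod q, oddInd (a * (r - a) - b * c) *
      (signEntries a b c (r - a) * χ (a * (r - a) - b * c)) = N r)
    (hq : 2 ∣ q) (r : ℤ) :
    glSum q (fun A => traceInd r q A * (signTwo (reduceMat hq A) * χ A.det)) = N r := by
  rw [glSum_traceInd_eq_oddInd hU, ← h]
  simp only [signTwo_reduceMat, Matrix.det_fin_two_of]

theorem glSum_koblitzInd_sign_of_entries {χ : ZMod q →* ℤ} {N : ℤ}
    (h : ∑ a : ZMod q, ∑ b : ZMod q, ∑ c : ZMod q, ∑ e : ZMod q,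
      oddInd (a * e - b * c) * (oddInd ((1 - a) * (1 - e) - b * c) *
        (signEntries a b c e * χ (a * e - b * c))) = N)
    (hq : 2 ∣ q) :
    glSum q (fun A => koblitzInd q A * (signTwo (reduceMat hq A) * χ A.det)) = N := by
  rw [glSum_eq_oddInd hU, ← h]
  simp only [signTwo_reduceMat, Matrix.det_fin_two_of, koblitzInd_eq_oddInd hU]

end TwoPower

theorem intCast_eq_zero_of_even {q : ℕ} (hq : 2 ∣ q) [NeZero q] (r : ℤ) :
    (r : ZMod 2) = 0 ↔ ((r : ZMod q)).val % 2 = 0 := by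
  rw [← map_intCast (ZMod.castHom hq (ZMod 2)) r, ZMod.castHom_apply, ZMod.cast_eq_val,
    ZMod.natCast_eq_zero_iff_even, Nat.even_iff]

/-! ### The Kronecker symbol as a product of local symbols -/

/-- For d > 0 this is reciprocity with no sign. For d < 0 one has |d| ≡ 3 mod 4, and the sign χ₄(m)
from (-1/m) cancels the sign in the reciprocity law. -/
theorem jacobiSym_of_one_mod_four {d : ℤ} (hd : d % 4 = 1) {m : ℕ} (hm : Odd m) :
    jacobiSym d m = jacobiSym m d.natAbs := by
  rcases Int.natAbs_eq d with h | h
  · conv_lhs => rw [h]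
    rw [jacobiSym.quadratic_reciprocity_one_mod_four (by omega) hm]
  · have h3 : d.natAbs % 4 = 3 := by omega
    conv_lhs => rw [h]
    rw [jacobiSym.neg _ hm]
    rcases Nat.odd_mod_four_iff.mp (Nat.odd_iff.mp hm) with h1 | h1
    · rw [ZMod.χ₄_nat_one_mod_four h1, one_mul,
        jacobiSym.quadratic_reciprocity_one_mod_four' (Nat.odd_iff.mpr (by omega)) h1]
    · rw [ZMod.χ₄_nat_three_mod_four h1,
        jacobiSym.quadratic_reciprocity_three_mod_four h3 h1]
      ring

theorem jacobiSym_of_three_mod_four {d : ℤ} (hd : d % 4 = 3) {m : ℕ} (hm : Odd m) :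
    jacobiSym d m = ZMod.χ₄ m * jacobiSym m d.natAbs := by
  rw [← neg_neg d, jacobiSym.neg _ hm, jacobiSym_of_one_mod_four (d := -d) (by omega) hm,
    Int.natAbs_neg, neg_neg]

/-- It makes 1 + 2ᵏ congruent to 1 modulo the gcd; this is the witness 3 for q = 4 and 5 for q = 8
in the field `conductor`. -/
theorem gcd_two_pow_dvd {n k : ℕ} (h : ¬ 2 ^ (k + 1) ∣ n) : n.gcd (2 ^ (k + 1)) ∣ 2 ^ k := by
  obtain ⟨i, hi, hi'⟩ := (Nat.dvd_prime_pow Nat.prime_two).mp (n.gcd_dvd_right (2 ^ (k + 1)))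
  rw [hi']
  refine pow_dvd_pow 2 (Nat.le_of_lt_succ (lt_of_le_of_ne hi ?_))
  rintro rfl
  exact h (hi' ▸ n.gcd_dvd_left _)

theorem splitting_of_one_mod_four {d : ℤ} (hd : d % 4 = 1) :
    Splitting d 1 2 d.natAbs 1 where
  h_eq := by simp [twoExp, hd]
  q_eq := rfl
  W_eq := by
    have : Int.gcd d 2 = 1 := Nat.coprime_two_right.mpr (Nat.odd_iff.mpr (by omega))
    rw [oddPart, this, Nat.div_one]
  W_odd := Nat.odd_iff.mpr (by omega)
  level := if_pos hd
  jacobi m hm := by rw [jacobiSym_of_one_mod_four hd hm, MonoidHom.one_apply, one_mul]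
  conductor n hn hqn := absurd hn hqn
  card := by rw [glSum_one_of_entries isUnit_zmod_two (N := 6) (by decide +kernel)]; rfl
  traceCount r := by
    rw [glSum_traceInd_of_entries isUnit_zmod_two (N := fun r => if r.val % 2 = 0 then 4 else 2)
      (by decide +kernel)]
    simp only [intCast_eq_zero_of_even (q := 2) (by norm_num)]
    rfl
  koblitzCount := by
    rw [glSum_koblitzInd_of_entries isUnit_zmod_two (N := 2) (by decide +kernel)]; rfl
  traceSum hq r := by
    rw [glSum_traceInd_sign_of_entries isUnit_zmod_two
      (N := fun r => -2 * (if r = 0 then 1 else if r = 1 then -1 else 0)) ]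
    · have : ¬ (2 ∣ d) := by omega
      simp [chiFour, this]
    · simp only [MonoidHom.one_apply, mul_one]
      decide +kernel
  koblitzSum hq := by
    rw [if_pos hd]
    refine glSum_koblitzInd_sign_of_entries isUnit_zmod_two ?_ hq
    simp only [MonoidHom.one_apply, mul_one]
    decide +kernel

theorem splitting_of_three_mod_four {d : ℤ} (hd : d % 4 = 3) :
    Splitting d 2 4 d.natAbs ZMod.χ₄.toMonoidHom where
  h_eq := by simp [twoExp, hd]
  q_eq := rfl
  W_eq := by
    have : Int.gcd d 2 = 1 := Nat.coprime_two_right.mpr (Nat.odd_iff.mpr (by omega))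
    rw [oddPart, this, Nat.div_one]
  W_odd := Nat.odd_iff.mpr (by omega)
  level := if_neg (by omega)
  jacobi m hm := jacobiSym_of_three_mod_four hd hm
  conductor n hn hqn := by
    refine ⟨3, by decide, ?_, by decide⟩
    exact ((Nat.modEq_iff_dvd' (by norm_num)).mpr (gcd_two_pow_dvd (k := 1) hqn)).symm
  card := by rw [glSum_one_of_entries isUnit_zmod_four (N := 96) (by decide +kernel)]; rfl
  traceCount r := by
    rw [glSum_traceInd_of_entries isUnit_zmod_four
      (N := fun r => 8 * if r.val % 2 = 0 then 4 else 2) (by decide +kernel)]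
    simp only [intCast_eq_zero_of_even (q := 4) (by norm_num)]
    norm_num [← mul_assoc]
  koblitzCount := by
    rw [glSum_koblitzInd_of_entries isUnit_zmod_four (N := 32) (by decide +kernel)]; rfl
  traceSum hq r := by
    rw [glSum_traceInd_sign_of_entries isUnit_zmod_four
      (N := fun r => -8 * (if r = 0 then 1 else if r = 2 then -1 else 0)) (by decide +kernel)]
    have : ¬ (2 ∣ d) := by omega
    simp [chiFour, this]
  koblitzSum hq := by
    rw [if_neg (by omega)]
    exact glSum_koblitzInd_sign_of_entries isUnit_zmod_four (by decide +kernel) hq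

/-- The character modulo 8 depends on d/2 modulo 4, so the finite checks that involve it are taken
as hypotheses; the counts without a character are common to both cases. -/
theorem splitting_of_even {d d' : ℤ} (hd : d = 2 * d') (s : ℤ) (χ : ZMod 8 →* ℤ)
    (hs : ZMod.χ₄ ((-d' : ℤ) : ZMod 4) = s) (hd' : d' % 2 = 1)
    (hχ : ∀ m : ℕ, Odd m → jacobiSym d m = χ m * jacobiSym m d'.natAbs)
    (hχ5 : χ 5 = -1)
    (htr : ∀ r : ZMod 8, ∑ a : ZMod 8, ∑ b : ZMod 8, ∑ c : ZMod 8, oddInd (a * (r - a) - b * c) *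
      (signEntries a b c (r - a) * χ (a * (r - a) - b * c)) =
        -32 * s * (if r = 0 then 1 else if r = 4 then -1 else 0))
    (hko : ∑ a : ZMod 8, ∑ b : ZMod 8, ∑ c : ZMod 8, ∑ e : ZMod 8,
      oddInd (a * e - b * c) * (oddInd ((1 - a) * (1 - e) - b * c) *
        (signEntries a b c e * χ (a * e - b * c))) = 0) :
    Splitting d 4 8 d'.natAbs χ where
  h_eq := by
    rw [twoExp, if_neg (by omega), if_neg (by omega)]
    rfl
  q_eq := rfl
  W_eq := by
    have : Int.gcd d 2 = 2 := Nat.gcd_eq_right 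
      (Int.natCast_dvd.mp (show ((2 : ℕ) : ℤ) ∣ d from Dvd.intro d' hd.symm))
    rw [oddPart, this, hd, Int.natAbs_mul]
    simp
  W_odd := Nat.odd_iff.mpr (by omega)
  level := by rw [if_neg (by omega)]; omega
  jacobi := hχ
  conductor n hn hqn := by
    refine ⟨5, by decide, ?_, by exact_mod_cast hχ5⟩
    exact ((Nat.modEq_iff_dvd' (by norm_num)).mpr (gcd_two_pow_dvd (k := 2) hqn)).symm
  card := by rw [glSum_one_of_entries isUnit_zmod_eight (N := 1536) (by decide +kernel)]; rfl
  traceCount r := by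
    rw [glSum_traceInd_of_entries isUnit_zmod_eight
      (N := fun r => 64 * if r.val % 2 = 0 then 4 else 2) (by decide +kernel)]
    simp only [intCast_eq_zero_of_even (q := 8) (by norm_num)]
    norm_num [← mul_assoc]
  koblitzCount := by
    rw [glSum_koblitzInd_of_entries isUnit_zmod_eight (N := 512) (by decide +kernel)]; rfl
  traceSum hq r := by
    rw [glSum_traceInd_sign_of_entries isUnit_zmod_eight htr]
    have : -d / 2 = -d' := by omega
    rw [chiFour, if_pos (Dvd.intro d' hd.symm), this, hs]
    norm_num
  koblitzSum hq := by
    rw [if_neg (by omega)]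
    exact glSum_koblitzInd_sign_of_entries isUnit_zmod_eight hko hq

theorem exists_splitting {d : ℤ} (hd : Squarefree d) :
    ∃ (h q W : ℕ) (χ : ZMod q →* ℤ), Splitting d h q W χ := by
  have h4 : ¬ (4 : ℤ) ∣ d := fun h => by
    have := hd 2 (by simpa using h)
    rw [Int.isUnit_iff] at this
    omega
  by_cases h1 : d % 4 = 1
  · exact ⟨_, _, _, _, splitting_of_one_mod_four h1⟩
  by_cases h3 : d % 4 = 3
  · exact ⟨_, _, _, _, splitting_of_three_mod_four h3⟩
  obtain ⟨d', rfl⟩ : (2 : ℤ) ∣ d := by omega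
  by_cases h1' : d' % 4 = 1
  · refine ⟨_, _, _, _, splitting_of_even rfl (-1) ZMod.χ₈.toMonoidHom ?_ (by omega) ?_ (by decide)
      (by decide +kernel) (by decide +kernel)⟩
    · exact ZMod.χ₄_int_three_mod_four (by omega)
    · intro m hm
      rw [jacobiSym.mul_left, jacobiSym.at_two hm, jacobiSym_of_one_mod_four h1' hm]
      rfl
  · have h3' : d' % 4 = 3 := by omega
    refine ⟨_, _, _, _, splitting_of_even rfl 1 ZMod.χ₈'.toMonoidHom ?_ (by omega) ?_ (by decide)
      (by decide +kernel) (by decide +kernel)⟩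
    · exact ZMod.χ₄_int_one_mod_four (by omega)
    · intro m hm
      -- Writing d = (-2)(-d') makes the odd factor ≡ 1 mod 4, so it adds no sign and the 2-part is
      -- the character of -2.
      rw [show 2 * d' = -2 * -d' by ring, jacobiSym.mul_left, jacobiSym.at_neg_two hm,
        jacobiSym_of_one_mod_four (d := -d') (by omega) hm, Int.natAbs_neg]
      rfl

end SerreCurve

namespace SerreCurve

/-! ### The character `ε(·) (d / det(·))` and its sums -/

/-- The character `ε(·) (d / det(·))` as a function of matrices modulo an even number. -/
def psi (d : ℤ) {n : ℕ} (h2 : 2 ∣ n) (A : Mat n) : ℤ :=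
  signTwo (reduceMat h2 A) * jacobiSym d A.det.val

theorem castHom_eq_natCast_val {m n : ℕ} [NeZero n] (h : m ∣ n) (x : ZMod n) :
    ZMod.castHom h (ZMod m) x = (x.val : ZMod m) := by
  rw [ZMod.castHom_apply, ZMod.cast_eq_val]

theorem odd_val_of_isUnit {n : ℕ} [NeZero n] (h2 : 2 ∣ n) {x : ZMod n} (hx : IsUnit x) :
    Odd x.val := by
  have := hx.map (ZMod.castHom h2 (ZMod 2))
  rw [castHom_eq_natCast_val, isUnit_iff_ne_zero] at this
  rwa [← ZMod.natCast_ne_zero_iff_odd]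

variable {d : ℤ} {h q W : ℕ} {χ : ZMod q →* ℤ}

/-- With g = gcd(W, r), the primes of g give ∏(p - 1) = φ(g) and each prime of W/g gives -1. -/
theorem prod_ite_dvd {W : ℕ} (hW : Squarefree W) (r : ℤ) :
    ∏ p ∈ W.primeFactors, (if (r : ZMod p) = 0 then (p : ℤ) - 1 else -1) =
      (-1) ^ (W / W.gcd r.natAbs).primeFactors.card * (Nat.totient (W.gcd r.natAbs) : ℤ) := by
  set g := W.gcd r.natAbs with hg
  have hgW : g ∣ W := Nat.gcd_dvd_left _ _
  have hg0 : g ≠ 0 := fun h => hW.ne_zero (by simpa [h] using hgW)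
  have hWg : W = g * (W / g) := (Nat.mul_div_cancel' hgW).symm
  have hcop : g.Coprime (W / g) := Nat.coprime_of_squarefree_mul (hWg ▸ hW)
  have hpf : W.primeFactors = g.primeFactors ∪ (W / g).primeFactors := by
    conv_lhs => rw [hWg]
    exact hcop.primeFactors_mul
  have h1 : ∏ p ∈ g.primeFactors, (if (r : ZMod p) = 0 then (p : ℤ) - 1 else -1) =
      (Nat.totient g : ℤ) := by
    rw [Nat.totient_eq_div_primeFactors_mul,
      Nat.prod_primeFactors_of_squarefree (hW.squarefree_of_dvd hgW),
      Nat.div_self (Nat.pos_of_ne_zero hg0), one_mul, Nat.cast_prod]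
    refine Finset.prod_congr rfl fun p hp => ?_
    have hpg := Nat.dvd_of_mem_primeFactors hp
    rw [if_pos, Nat.cast_sub (Nat.prime_of_mem_primeFactors hp).one_le, Nat.cast_one]
    rw [ZMod.intCast_zmod_eq_zero_iff_dvd]
    exact Int.natCast_dvd.mpr (hpg.trans (Nat.gcd_dvd_right _ _))
  have h2 : ∏ p ∈ (W / g).primeFactors, (if (r : ZMod p) = 0 then (p : ℤ) - 1 else -1) =
      (-1) ^ (W / g).primeFactors.card := by
    rw [← Finset.prod_const]
    refine Finset.prod_congr rfl fun p hp => if_neg fun hr => ?_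
    rw [ZMod.intCast_zmod_eq_zero_iff_dvd, Int.natCast_dvd] at hr
    have hpW := Nat.dvd_of_mem_primeFactors hp
    have hp' := Nat.prime_of_mem_primeFactors hp
    have hpg : p ∣ g := Nat.dvd_gcd (hpW.trans (Nat.div_dvd_of_dvd hgW)) hr
    exact hp'.one_lt.ne' (Nat.dvd_one.mp (hcop ▸ Nat.dvd_gcd hpg hpW))
  rw [hpf, Finset.prod_union hcop.disjoint_primeFactors, h1, h2, mul_comm]

theorem glSum_traceInd_jacobiMod (hW : Squarefree W) (hodd : Odd W) (r : ℤ) :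
    glSum W (fun A => traceInd r W A * jacobiMod W A.det) =
      W * ZMod.χ₄ W * ((-1) ^ (W / W.gcd r.natAbs).primeFactors.card *
        (Nat.totient (W.gcd r.natAbs) : ℤ)) := by
  rw [((isLocal_traceInd r).pointwise_mul isLocal_jacobiMod).glSum_eq_prod hW,
    ← prod_ite_dvd hW r]
  have h1 : ∏ p ∈ W.primeFactors, (p : ℤ) = W := by
    rw [← Nat.cast_prod, Nat.prod_primeFactors_of_squarefree hW]
  have h2 : ∏ p ∈ W.primeFactors, ZMod.χ₄ (p : ZMod 4) = ZMod.χ₄ W := by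
    rw [← map_prod, ← Nat.cast_prod, Nat.prod_primeFactors_of_squarefree hW]
  rw [← h1, ← h2, ← Finset.prod_mul_distrib, ← Finset.prod_mul_distrib]
  refine Finset.prod_congr rfl fun p hp => ?_
  have hp' := Nat.prime_of_mem_primeFactors hp
  have : Fact p.Prime := ⟨hp'⟩
  rw [glSum_traceInd_jacobiMod_prime p, mul_assoc]
  rintro rfl
  exact (Nat.not_even_iff_odd.mpr hodd)
    (even_iff_two_dvd.mpr (Nat.dvd_of_mem_primeFactors hp))

theorem glSum_koblitzInd_jacobiMod (hW : Squarefree W) (hodd : Odd W) :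
    glSum W (fun A => koblitzInd W A * jacobiMod W A.det) = W := by
  rw [(isLocal_koblitzInd.pointwise_mul isLocal_jacobiMod).glSum_eq_prod hW]
  conv_rhs => rw [← Nat.prod_primeFactors_of_squarefree hW, Nat.cast_prod]
  refine Finset.prod_congr rfl fun p hp => ?_
  have hp' := Nat.prime_of_mem_primeFactors hp
  have : Fact p.Prime := ⟨hp'⟩
  rw [glSum_koblitzInd_jacobiMod_prime p]
  rintro rfl
  exact (Nat.not_even_iff_odd.mpr hodd)
    (even_iff_two_dvd.mpr (Nat.dvd_of_mem_primeFactors hp))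

namespace Splitting

variable (S : Splitting d h q W χ)
include S

theorem h_pos : 0 < h := S.h_eq ▸ Nat.two_pow_pos _

theorem two_dvd_q : 2 ∣ q := ⟨h, S.q_eq⟩

theorem q_eq_two_pow : q = 2 ^ (twoExp d - 1 + 1) := by
  rw [S.q_eq, S.h_eq, pow_succ']

theorem q_pos : 0 < q := S.q_eq_two_pow ▸ Nat.two_pow_pos _

theorem W_pos : 0 < W := S.W_odd.pos

theorem coprime : q.Coprime W := by
  rw [S.q_eq_two_pow]
  exact Nat.Coprime.pow_left _ (Nat.coprime_two_left.mpr S.W_odd)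

theorem W_squarefree (hd : Squarefree d) : Squarefree W := by
  rw [S.W_eq, oddPart]
  exact (Int.squarefree_natAbs.mpr hd).squarefree_of_dvd (Nat.div_dvd_of_dvd (Nat.gcd_dvd_left _ _))

theorem primeFactors_mul : (q * W).primeFactors = insert 2 W.primeFactors := by
  rw [S.coprime.primeFactors_mul, S.q_eq_two_pow,
    Nat.primeFactors_prime_pow (Nat.succ_ne_zero _) Nat.prime_two, Finset.insert_eq]

theorem two_notMem : 2 ∉ W.primeFactors := fun hp =>
  (Nat.not_even_iff_odd.mpr S.W_odd) (even_iff_two_dvd.mpr (Nat.dvd_of_mem_primeFactors hp))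

/-- The determinant is a unit modulo an even number, so its representative is odd and reciprocity
moves it to the numerator of a Jacobi symbol with denominator W. This gives the factorization of ψ
along qW. -/
theorem psi_eq (h2 : 2 ∣ q * W) (A : Mat (q * W)) (hA : IsUnit A.det) :
    psi d h2 A =
      (signTwo (reduceMat S.two_dvd_q (reduceMat (Dvd.intro W rfl) A)) *
        χ (reduceMat (Dvd.intro W rfl) A).det) *
      jacobiMod W (reduceMat (Dvd.intro_left q rfl) A).det := by
  have : NeZero (q * W) := ⟨(Nat.mul_pos S.q_pos S.W_pos).ne'⟩
  rw [psi, S.jacobi _ (odd_val_of_isUnit h2 hA), reduceMat_reduceMat, det_reduceMat,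
    det_reduceMat, jacobiMod_castHom, castHom_eq_natCast_val, mul_assoc]

theorem glSum_local_mul_psi {F : ∀ n, Mat n → ℤ} (hF : IsLocal F) (h2 : 2 ∣ q * W) :
    glSum (q * W) (fun A => F (q * W) A * psi d h2 A) =
      glSum q (fun A => F q A * (signTwo (reduceMat S.two_dvd_q A) * χ A.det)) *
        glSum W (fun A => F W A * jacobiMod W A.det) := by
  have : NeZero q := ⟨S.q_pos.ne'⟩
  have : NeZero W := ⟨S.W_pos.ne'⟩
  rw [← glSum_mul S.coprime]
  refine glSum_congr fun A hA => ?_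
  rw [S.psi_eq h2 A hA, hF.mul q W S.coprime]
  ring

theorem glSum_local {F : ∀ n, Mat n → ℤ} (hF : IsLocal F) (hd : Squarefree d) :
    glSum (q * W) (F (q * W)) = glSum q (F q) * ∏ p ∈ W.primeFactors, glSum p (F p) := by
  have : NeZero q := ⟨S.q_pos.ne'⟩
  have : NeZero W := ⟨S.W_pos.ne'⟩
  rw [← hF.glSum_eq_prod (S.W_squarefree hd), ← glSum_mul S.coprime]
  exact congrArg _ (funext (hF.mul q W S.coprime))

/-- The origin of δ: the 2-part supplies -χ₄(-d/2) and the parity of r/h, the W-part supplies χ₄(W)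
= (-1)^((W-1)/2) and (-1)^ω. The minus sign turns (W - 1)/2 into (W + 1)/2. -/
theorem glSum_traceInd_psi (hd : Squarefree d) (h2 : 2 ∣ q * W) (r : ℤ) :
    glSum (q * W) (fun A => traceInd r (q * W) A * psi d h2 A) =
      if (2 : ℤ) ^ (twoExp d - 1) ∣ r then
        deltaSign d r * ((q * W : ℕ) * 2 ^ (twoExp d - 1) *
          Nat.totient ((oddPart d).gcd r.natAbs))
      else 0 := by
  have hh : (2 : ℤ) ^ (twoExp d - 1) = h := by rw [S.h_eq]; norm_num
  have hh0 : (h : ℤ) ≠ 0 := by exact_mod_cast S.h_pos.ne'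
  rw [S.glSum_local_mul_psi (isLocal_traceInd r), S.traceSum,
    glSum_traceInd_jacobiMod (S.W_squarefree hd) S.W_odd, deltaSign, hh, ← S.W_eq,
    ArithmeticFunction.cardDistinctFactors_apply]
  have hz : (r : ZMod q) = 0 ↔ (q : ℤ) ∣ r := ZMod.intCast_zmod_eq_zero_iff_dvd _ _
  have hz' : (r : ZMod q) = h ↔ (q : ℤ) ∣ r - h := by
    rw [← sub_eq_zero, ← ZMod.intCast_zmod_eq_zero_iff_dvd]
    push_cast
    rfl
  have hq : (q : ℤ) = h * 2 := by rw [S.q_eq]; push_cast; ring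
  rw [hq] at hz hz'
  by_cases hr : (h : ℤ) ∣ r
  · obtain ⟨s, rfl⟩ := hr
    -- As q = 2h, the class of r = hs modulo q is 0 for even s and h for odd s.
    have hs : (if ((h * s : ℤ) : ZMod q) = 0 then 1
        else if ((h * s : ℤ) : ZMod q) = h then -1 else 0) = (((-1 : ℤˣ) ^ s : ℤˣ) : ℤ) := by
      rw [mul_dvd_mul_iff_left hh0] at hz
      rw [show (h : ℤ) * s - h = h * (s - 1) by ring, mul_dvd_mul_iff_left hh0] at hz'
      rcases Int.even_or_odd s with he | ho
      · rw [if_pos (hz.mpr he.two_dvd), he.neg_one_zpow]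
        rfl
      · rw [if_neg fun h0 => Int.not_even_iff_odd.mpr ho (even_iff_two_dvd.mpr (hz.mp h0)),
          if_pos (hz'.mpr (by obtain ⟨t, rfl⟩ := ho; exact ⟨t, by ring⟩)), ho.neg_one_zpow]
        rfl
    obtain ⟨w, hw⟩ := S.W_odd
    have hw2 : ((W : ℤ) + 1) / 2 = w + 1 := by omega
    have hw3 : W / 2 = w := by omega
    rw [hs, if_pos (Dvd.intro _ rfl), Int.mul_ediv_cancel_left _ hh0, zpow_add, zpow_add,
      zpow_natCast, hw2, zpow_add_one, zpow_natCast,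
      ZMod.χ₄_eq_neg_one_pow (Nat.odd_iff.mp ⟨w, hw⟩), hw3, ← List.card_toFinset]
    change _ * (_ * _ * ((-1) ^ (W / W.gcd (h * s : ℤ).natAbs).primeFactors.card * _)) =
      ((((-1) ^ (W / W.gcd (h * s : ℤ).natAbs).primeFactors.card * ((-1) ^ w * (-1)) *
        (-1) ^ s : ℤˣ) : ℤ)) * _ * _
    push_cast
    ring
  · rw [if_neg hr, if_neg, if_neg, mul_zero, zero_mul]
    · exact fun h0 => hr ((dvd_sub_self_right).mp ((Dvd.intro _ rfl).trans (hz'.mp h0)))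
    · exact fun h0 => hr ((Dvd.intro _ rfl).trans (hz.mp h0))

theorem glSum_koblitzInd_psi (hd : Squarefree d) (h2 : 2 ∣ q * W) :
    glSum (q * W) (fun A => koblitzInd (q * W) A * psi d h2 A) =
      if d % 4 = 1 then 2 * (W : ℤ) else 0 := by
  rw [S.glSum_local_mul_psi isLocal_koblitzInd, S.koblitzSum,
    glSum_koblitzInd_jacobiMod (S.W_squarefree hd) S.W_odd]
  split_ifs <;> simp

end Splitting

end SerreCurve

namespace SerreCurve

/-! ### Surjectivity of the reduction maps `GL₂(Ẑ) → GL₂(ℤ/nℤ)` -/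

/-- By pigeonhole the powers of a become periodic from an exponent at most k on, with a period at
most k. Hence k! lies beyond the preperiod and is a multiple of the period, so doubling the exponent
changes nothing. -/
theorem pow_factorial_idempotent {k : ℕ} [NeZero k] (a : ZMod k) :
    a ^ k.factorial * a ^ k.factorial = a ^ k.factorial := by
  obtain ⟨i, j, hij, h⟩ := Fintype.exists_ne_map_eq_of_card_lt
    (fun i : Fin (k + 1) => a ^ (i : ℕ)) (by simp)
  wlog hlt : i < j generalizing i j
  · exact this j i hij.symm h.symm (lt_of_le_of_ne (not_lt.mp hlt) hij.symm)
  have hlt' : (i : ℕ) < j := hlt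
  have hj : (j : ℕ) ≤ k := Nat.lt_succ_iff.mp j.2
  obtain ⟨s, hs⟩ : ((j : ℕ) - i) ∣ k.factorial :=
    Nat.dvd_factorial (by omega) (by omega)
  have hk : k ≤ k.factorial := Nat.self_le_factorial k
  have step : ∀ m : ℕ, (i : ℕ) ≤ m → a ^ (m + (j - i)) = a ^ m := fun m hm => by
    obtain ⟨t, rfl⟩ := Nat.exists_eq_add_of_le hm
    rw [show (i : ℕ) + t + (j - i) = j + t by omega, pow_add, pow_add, h]
  have steps : ∀ s : ℕ, a ^ (k.factorial + (j - i) * s) = a ^ k.factorial := fun s => by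
    induction s with
    | zero => simp
    | succ s ih => rw [mul_add, mul_one, ← add_assoc, step _ (by omega), ih]
  rw [← pow_add]
  conv_lhs => rw [hs]
  rw [← steps s]
  congr 1
  omega

theorem pow_factorial_mul {k : ℕ} [NeZero k] (a : ZMod k) {t : ℕ} (ht : t ≠ 0) :
    a ^ (k.factorial * t) = a ^ k.factorial := by
  rw [pow_mul]
  exact IsIdempotentElem.pow_eq (pow_factorial_idempotent a) ht

namespace ZHat

theorem isUnit_of_forall {x : ZHat} (hx : ∀ n : ℕ+, IsUnit (x.1 n)) : IsUnit x := by
  have hinv (n : ℕ+) : x.1 n * Ring.inverse (x.1 n) = 1 := Ring.mul_inverse_cancel _ (hx n)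
  refine IsUnit.of_mul_eq_one ⟨fun n => Ring.inverse (x.1 n), fun n m h => ?_⟩
    (Subtype.ext (funext hinv))
  refine (hx n).mul_left_cancel ?_
  rw [hinv, ← x.2 n m h, ← map_mul, hinv, map_one]

/-- The idempotent of `Ẑ` that is `0` at the primes dividing `N` and `1` at the other primes. -/
def awayIdempotent (N : ℕ) : ZHat :=
  ⟨fun k => (N : ZMod k) ^ (k : ℕ).factorial, fun n m h => by
    rw [map_pow, map_natCast]
    obtain ⟨t, ht⟩ := Nat.factorial_dvd_factorial (Nat.le_of_dvd m.pos h)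
    rw [ht, pow_factorial_mul]
    rintro rfl
    exact Nat.factorial_ne_zero _ ht⟩

theorem awayIdempotent_mul_self (N : ℕ) :
    awayIdempotent N * awayIdempotent N = awayIdempotent N :=
  Subtype.ext (funext fun _ => pow_factorial_idempotent _)

theorem proj_awayIdempotent (N : ℕ+) : proj N (awayIdempotent N) = 0 := by
  change ((N : ℕ) : ZMod N) ^ (N : ℕ).factorial = 0
  rw [ZMod.natCast_self, zero_pow (Nat.factorial_ne_zero _)]

theorem isUnit_extend {N : ℕ} {D : ℤ} (hD : IsCoprime D N) :
    IsUnit (awayIdempotent N + (1 - awayIdempotent N) * (D : ZHat)) := by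
  refine isUnit_of_forall fun k => ?_
  obtain ⟨a, b, hab⟩ := hD
  set f : ZMod k := (N : ZMod k) ^ (k : ℕ).factorial with hf
  have hff : f * f = f := pow_factorial_idempotent _
  change IsUnit (f + (1 - f) * ((D : ZHat).1 k))
  rw [show ((D : ZHat).1 k) = (D : ZMod k) from map_intCast (proj k) D]
  have hab' : (a : ZMod k) * D + b * N = 1 := by exact_mod_cast congrArg (Int.cast : ℤ → ZMod k) hab
  obtain ⟨c, hc⟩ : 1 - (b : ZMod k) * N ∣ 1 - ((b : ZMod k) * N) ^ (k : ℕ).factorial :=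
    one_sub_dvd_one_sub_pow _ _
  rw [mul_pow, ← hf, ← hab', add_sub_cancel_right] at hc
  -- Where f = 1 the element is 1. On the complement (bN)^(k!) = b^(k!) f vanishes, so aD = 1 - bN
  -- has the geometric sum c as inverse, and D has inverse ac.
  refine IsUnit.of_mul_eq_one (f + (1 - f) * (a * c)) ?_
  clear hf
  clear_value f
  linear_combination (1 - a * c - D + D * a * c + (b : ZMod k) ^ (k : ℕ).factorial) * hff -
    (1 - f) * hc + (1 - f) * hab'

end ZHat

/-- Lift the entries to integers and glue with the identity matrix away from N by means of the
idempotent f. The determinant f + (1 - f)D is a unit because D is coprime to N, and f is 0 modulo N.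
-/
theorem reduction_surjective (N : ℕ+) : Function.Surjective (reduction N) := by
  intro g
  set f := ZHat.awayIdempotent N with hf
  have hff : f * f = f := ZHat.awayIdempotent_mul_self N
  have hfN : ZHat.proj N f = 0 := ZHat.proj_awayIdempotent N
  set z : Fin 2 → Fin 2 → ℤ := fun i j => ((g.1 i j).val : ℤ) with hz
  have hzg (i j) : ((z i j : ℤ) : ZMod N) = g.1 i j := by simp [hz]
  set D : ℤ := z 0 0 * z 1 1 - z 0 1 * z 1 0 with hD
  have hDg : (D : ZMod N) = g.1.det := by
    rw [hD, Matrix.det_fin_two]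
    push_cast
    simp only [hzg]
  have hcop : IsCoprime D N := by
    exact ((ZMod.coe_int_isUnit_iff_isCoprime _ _).mp (hDg ▸ isUnit_det g)).symm
  set A : Matrix (Fin 2) (Fin 2) ZHat :=
    Matrix.of fun i j => (1 - f) * (z i j : ZHat) + f * (1 : Matrix (Fin 2) (Fin 2) ZHat) i j
    with hA
  have hdet : A.det = f + (1 - f) * (D : ZHat) := by
    rw [Matrix.det_fin_two, hD]
    simp [hA]
    linear_combination (1 - (z 0 0 : ZHat) - z 1 1 + (z 0 0 : ZHat) * z 1 1 -
      (z 0 1 : ZHat) * z 1 0) * hff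
  refine ⟨Matrix.GeneralLinearGroup.mk'' A (hdet ▸ ZHat.isUnit_extend hcop), ?_⟩
  ext i j
  change ZHat.proj N ((1 - f) * (z i j : ZHat) + f * (1 : Matrix (Fin 2) (Fin 2) ZHat) i j) = _
  rw [map_add, map_mul, map_mul, map_sub, hfN, map_one, map_intCast, hzg]
  ring

theorem map_castHom_reduction {n m : ℕ+} (h : (n : ℕ) ∣ m) (x : GL (Fin 2) ZHat) :
    Matrix.GeneralLinearGroup.map (ZMod.castHom h (ZMod n)) (reduction m x) = reduction n x := by
  ext i j
  exact (x.1 i j).2 n m h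

/-! ### Change of basis -/

variable {E : WeierstrassCurve ℚ}

/-- The change of coordinates between two bases, modulo `n`. -/
def changeEnd (b b' : TorsionBasis E) (n : ℕ+) : (Fin 2 → ZMod n) →ₗ[ZMod n] (Fin 2 → ZMod n) :=
  AddMonoidHom.toZModLinearMap n
    ((b'.coord n).toAddMonoidHom.comp (b.coord n).symm.toAddMonoidHom)

theorem changeEnd_apply (b b' : TorsionBasis E) (n : ℕ+) (v : Fin 2 → ZMod n) :
    changeEnd b b' n v = b'.coord n ((b.coord n).symm v) := rfl

/-- The matrix of the change of coordinates between two bases, modulo `n`. -/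
def changeMatrix (b b' : TorsionBasis E) (n : ℕ+) : Mat n := LinearMap.toMatrix' (changeEnd b b' n)

theorem coord_symm_single (b : TorsionBasis E) {n m : ℕ+} (h : (n : ℕ) ∣ m) (j : Fin 2) :
    ((b.coord n).symm (Pi.single j 1) : (E⁄QBar).Point) =
      ((m : ℕ) / (n : ℕ)) • ((b.coord m).symm (Pi.single j 1) : (E⁄QBar).Point) := by
  have hmem : ((m : ℕ) / (n : ℕ)) •
      ((b.coord m).symm (Pi.single j 1) : (E⁄QBar).Point) ∈ torsion E n := by
    change (n : ℕ) • (((m : ℕ) / (n : ℕ)) •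
      ((b.coord m).symm (Pi.single j 1) : (E⁄QBar).Point)) = 0
    rw [smul_smul, Nat.mul_div_cancel' h]
    exact ((b.coord m).symm (Pi.single j 1)).2
  have key : (b.coord n).symm (Pi.single j 1) = ⟨_, hmem⟩ := by
    rw [AddEquiv.symm_apply_eq]
    funext i
    rw [b.compat n m h _ ⟨_, hmem⟩ rfl i, AddEquiv.apply_symm_apply]
    by_cases hij : i = j
    · subst hij
      rw [Pi.single_eq_same, Pi.single_eq_same, map_one]
    · rw [Pi.single_eq_of_ne hij, Pi.single_eq_of_ne hij, map_zero]
  rw [key]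

theorem changeMatrix_compat (b b' : TorsionBasis E) (i j : Fin 2) (n m : ℕ+) (h : (n : ℕ) ∣ m) :
    ZMod.castHom h (ZMod n) (changeMatrix b b' m i j) = changeMatrix b b' n i j := by
  simp only [changeMatrix, LinearMap.toMatrix'_apply, changeEnd_apply]
  exact (b'.compat n m h _ _ (coord_symm_single b h j) i).symm

theorem changeMatrix_mul_changeMatrix (b b' : TorsionBasis E) (n : ℕ+) :
    changeMatrix b b' n * changeMatrix b' b n = 1 := by
  rw [changeMatrix, changeMatrix, ← LinearMap.toMatrix'_comp, ← LinearMap.toMatrix'_id]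
  congr 1
  refine LinearMap.ext fun v => ?_
  simp [changeEnd_apply]

theorem changeMatrix_mul_actMatrix (b b' : TorsionBasis E) (n : ℕ+)
    (σ : Field.absoluteGaloisGroup ℚ) :
    changeMatrix b b' n * actMatrix b n σ = actMatrix b' n σ * changeMatrix b b' n := by
  rw [changeMatrix, actMatrix, actMatrix, ← LinearMap.toMatrix'_comp, ← LinearMap.toMatrix'_comp]
  congr 1
  refine LinearMap.ext fun v => ?_
  simp [changeEnd_apply, actEnd_apply]

/-- The matrix over `Ẑ` of the change of coordinates between two bases. -/
def changeMatrixZHat (b b' : TorsionBasis E) : Matrix (Fin 2) (Fin 2) ZHat :=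
  Matrix.of fun i j => ⟨fun n => changeMatrix b b' n i j, changeMatrix_compat b b' i j⟩

theorem matrix_zHat_ext {A B : Matrix (Fin 2) (Fin 2) ZHat}
    (h : ∀ n, A.map (ZHat.proj n) = B.map (ZHat.proj n)) : A = B :=
  Matrix.ext fun i j => Subtype.ext (funext fun n => congrFun (congrFun (h n) i) j)

theorem changeMatrixZHat_mul (b b' : TorsionBasis E) :
    changeMatrixZHat b b' * changeMatrixZHat b' b = 1 := by
  refine matrix_zHat_ext fun n => ?_
  rw [Matrix.map_mul, Matrix.map_one _ (map_zero _) (map_one _)]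
  exact changeMatrix_mul_changeMatrix b b' n

/-- `IsSerreCurve` speaks of one basis and the constants of another; conjugacy carries the
description of the image from the first to the second. -/
theorem exists_conj_adelicRep (b b' : TorsionBasis E) :
    ∃ u : GL (Fin 2) ZHat, ∀ σ, adelicRep b' σ = u * adelicRep b σ * u⁻¹ := by
  refine ⟨⟨changeMatrixZHat b b', changeMatrixZHat b' b, changeMatrixZHat_mul b b',
    changeMatrixZHat_mul b' b⟩, fun σ => ?_⟩
  rw [eq_mul_inv_iff_mul_eq]
  refine Units.ext (matrix_zHat_ext fun n => ?_)
  rw [Units.val_mul, Units.val_mul, Matrix.map_mul, Matrix.map_mul]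
  exact (changeMatrix_mul_actMatrix b b' n σ).symm

end SerreCurve

namespace SerreCurve

/-! ### The character `ψ` and its conductor -/

theorem signTwo_mul (A B : Mat 2) (hA : IsUnit A.det) (hB : IsUnit B.det) :
    signTwo (A * B) = signTwo A * signTwo B := by
  have key : ∀ a b c e a' b' c' e' : ZMod 2, a * e - b * c ≠ 0 → a' * e' - b' * c' ≠ 0 →
      signTwo (!![a, b; c, e] * !![a', b'; c', e']) =
        signTwo !![a, b; c, e] * signTwo !![a', b'; c', e'] := by
    decide +kernel
  rw [Matrix.eta_fin_two A, Matrix.eta_fin_two B]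
  rw [isUnit_iff_ne_zero, Matrix.det_fin_two] at hA hB
  exact key _ _ _ _ _ _ _ _ hA hB

theorem reduceMat_mul {m n : ℕ} (h : m ∣ n) (A B : Mat n) :
    reduceMat h (A * B) = reduceMat h A * reduceMat h B := Matrix.map_mul

theorem reduceMat_one {m n : ℕ} (h : m ∣ n) : reduceMat h (1 : Mat n) = 1 :=
  Matrix.map_one _ (map_zero _) (map_one _)

theorem isUnit_det_reduceMat {m n : ℕ} (h : m ∣ n) {A : Mat n} (hA : IsUnit A.det) :
    IsUnit (reduceMat h A).det := det_reduceMat h A ▸ hA.map _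

theorem signTwo_one : signTwo 1 = 1 := by decide

theorem jacobiMod_one (n : ℕ) [NeZero n] : jacobiMod n 1 = 1 := by
  rw [← Nat.cast_one, jacobiMod_natCast, Nat.cast_one, jacobiSym.one_left]

variable {d : ℤ} {h q W : ℕ} {χ : ZMod q →* ℤ}

namespace Splitting

variable (S : Splitting d h q W χ)
include S

theorem psi_mul (h2 : 2 ∣ q * W) (A B : Mat (q * W)) (hA : IsUnit A.det) (hB : IsUnit B.det) :
    psi d h2 (A * B) = psi d h2 A * psi d h2 B := by
  have : NeZero W := ⟨S.W_pos.ne'⟩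
  rw [S.psi_eq h2 _ (by rw [Matrix.det_mul]; exact hA.mul hB), S.psi_eq h2 A hA, S.psi_eq h2 B hB]
  simp only [reduceMat_mul, Matrix.det_mul, map_mul, jacobiMod_mul]
  rw [signTwo_mul _ _ (isUnit_det_reduceMat _ (isUnit_det_reduceMat _ hA))
    (isUnit_det_reduceMat _ (isUnit_det_reduceMat _ hB))]
  ring

theorem psi_one (h2 : 2 ∣ q * W) : psi d h2 1 = 1 := by
  have : NeZero W := ⟨S.W_pos.ne'⟩
  rw [S.psi_eq h2 _ (by simp)]
  simp only [reduceMat_one, Matrix.det_one, map_one, signTwo_one, jacobiMod_one, mul_one]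

theorem psi_of_det_eq_one (h2 : 2 ∣ q * W) (A : Mat (q * W)) (hA : A.det = 1) :
    psi d h2 A = signTwo (reduceMat h2 A) := by
  have : NeZero W := ⟨S.W_pos.ne'⟩
  rw [S.psi_eq h2 _ (by simp [hA])]
  simp only [det_reduceMat, hA, map_one, jacobiMod_one, mul_one, reduceMat_reduceMat]

theorem psi_diag (h2 : 2 ∣ q * W) {D : ℕ} (hD : D.Coprime (q * W)) :
    psi d h2 !![1, 0; 0, (D : ZMod (q * W))] = χ D * jacobiSym D W := by
  have : NeZero W := ⟨S.W_pos.ne'⟩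
  have hdet : (!![1, 0; 0, (D : ZMod (q * W))] : Mat (q * W)).det = D := by simp
  have hD2 : (D : ZMod 2) = 1 := by
    rw [ZMod.natCast_eq_one_iff_odd]
    exact Nat.coprime_two_right.mp (hD.coprime_dvd_right h2)
  have h1 : reduceMat h2 !![1, 0; 0, (D : ZMod (q * W))] = 1 := by
    ext i j
    fin_cases i <;> fin_cases j <;> simp [reduceMat, hD2, -ZMod.castHom_apply]
  rw [S.psi_eq h2 _ (by rw [hdet]; exact (ZMod.isUnit_iff_coprime _ _).mpr hD),
    reduceMat_reduceMat, h1, signTwo_one, det_reduceMat, det_reduceMat, hdet,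
    map_natCast (ZMod.castHom _ (ZMod q)), map_natCast (ZMod.castHom _ (ZMod W)), jacobiMod_natCast, one_mul]

/-- Take D ≡ 1 mod nW and D ≡ u mod q, with u from `conductor`. These congruences are compatible
because gcd(nW, q) = gcd(n, q), W being coprime to q. -/
theorem exists_nontrivial_of_not_q_dvd {n : ℕ} (hn2 : 2 ∣ n) (hqn : ¬ q ∣ n) :
    ∃ D : ℕ, D ≡ 1 [MOD n] ∧ D.Coprime (q * W) ∧ χ D * jacobiSym D W = -1 := by
  obtain ⟨u, hu, hun, hχu⟩ := S.conductor n hn2 hqn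
  have hg : (n * W).gcd q = n.gcd q := Nat.Coprime.gcd_mul_right_cancel n S.coprime.symm
  obtain ⟨D, hD1, hDu⟩ := Nat.chineseRemainder' (m := q) (n := n * W) (a := 1) (b := u)
    (hg ▸ hun.symm)
  have hDW : D ≡ 1 [MOD W] := hD1.of_mul_left n
  refine ⟨D, hD1.of_mul_right W, Nat.Coprime.mul_right ?_ ?_, ?_⟩
  · rw [S.q_eq_two_pow]
    refine Nat.Coprime.pow_right _ (Nat.coprime_two_right.mpr ?_)
    have := hDu.of_dvd S.two_dvd_q
    rw [Nat.odd_iff] at hu ⊢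
    rw [← hu]
    exact this
  · exact (hDW.gcd_eq).trans (Nat.gcd_one_left _)
  · have h1 : (D : ZMod q) = u := (ZMod.natCast_eq_natCast_iff _ _ _).mpr hDu
    have h3 : jacobiSym D W = jacobiSym 1 W :=
      jacobiSym.mod_left' (by exact_mod_cast hDW)
    rw [h1, hχu, h3, jacobiSym.one_left, mul_one]

/-- Some prime p of the square-free W does not divide n. Take D ≡ 1 modulo n, q and W/p, and a
quadratic non-residue modulo p. -/
theorem exists_nontrivial_of_not_W_dvd (hd : Squarefree d) {n : ℕ} (hWn : ¬ W ∣ n) :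
    ∃ D : ℕ, D ≡ 1 [MOD n] ∧ D.Coprime (q * W) ∧ χ D * jacobiSym D W = -1 := by
  have hW := S.W_squarefree hd
  obtain ⟨p, hpW, hpn⟩ : ∃ p ∈ W.primeFactors, ¬ p ∣ n := by
    by_contra! hcon
    refine hWn ?_
    rw [← Nat.prod_primeFactors_of_squarefree hW]
    exact Finset.prod_primes_dvd n (fun p hp => (Nat.prime_of_mem_primeFactors hp).prime) hcon
  have hp := Nat.prime_of_mem_primeFactors hpW
  have : Fact p.Prime := ⟨hp⟩
  obtain ⟨V, rfl⟩ := Nat.dvd_of_mem_primeFactors hpW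
  have hV : NeZero V := ⟨fun h => hW.ne_zero (by simp [h])⟩
  have hp2 : p ≠ 2 := by
    rintro rfl
    exact S.two_notMem hpW
  have hpV : p.Coprime V := Nat.coprime_of_squarefree_mul hW
  have hpq : p.Coprime q := (S.coprime.coprime_dvd_right (Dvd.intro V rfl)).symm
  have hco : (n * (q * V)).Coprime p :=
    Nat.Coprime.symm (((hp.coprime_iff_not_dvd).mpr hpn).mul_right (hpq.mul_right hpV))
  obtain ⟨ν, hν⟩ := quadraticChar_exists_neg_one (F := ZMod p) (by rwa [ZMod.ringChar_zmod_n])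
  obtain ⟨D, hD1, hDν⟩ := Nat.chineseRemainder hco 1 ν.val
  have hDq : D ≡ 1 [MOD q] := (hD1.of_mul_left n).of_mul_right V
  have hDV : D ≡ 1 [MOD V] := (hD1.of_mul_left n).of_mul_left q
  have hDp : (D : ZMod p) = ν := by
    rw [← ZMod.natCast_zmod_val ν]
    exact (ZMod.natCast_eq_natCast_iff _ _ _).mpr hDν
  have hJp : jacobiSym D p = -1 := by
    rw [← jacobiMod_natCast, jacobiMod_prime, hDp, hν]
  refine ⟨D, hD1.of_mul_right _, Nat.Coprime.mul_right ?_ (Nat.Coprime.mul_right ?_ ?_), ?_⟩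
  · exact (hDq.gcd_eq).trans (Nat.gcd_one_left _)
  · rw [Nat.coprime_comm, hp.coprime_iff_not_dvd]
    intro hpD
    rw [← hDp, (ZMod.natCast_eq_zero_iff _ _).mpr hpD, MulChar.map_zero] at hν
    exact absurd hν (by norm_num)
  · exact (hDV.gcd_eq).trans (Nat.gcd_one_left _)
  · have h1 : (D : ZMod q) = 1 := by
      rw [← Nat.cast_one]
      exact (ZMod.natCast_eq_natCast_iff _ _ _).mpr hDq
    have h3 : jacobiSym D V = jacobiSym 1 V := jacobiSym.mod_left' (by exact_mod_cast hDV)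
    rw [h1, map_one, jacobiSym.mul_right, hJp, h3, jacobiSym.one_left]
    norm_num

/-- For even n the matrix diag(1, D) has trivial signature and detects the determinant character.
For odd n a transvection with entry n is trivial modulo n, has determinant 1, and is a transposition
modulo 2. -/
theorem exists_psi_eq_neg_one (hd : Squarefree d) {M : ℕ+} (hM : (M : ℕ) = q * W) (h2 : 2 ∣ (M : ℕ))
    {n : ℕ+} (hMn : ¬ (M : ℕ) ∣ n) :
    ∃ x : GL (Fin 2) ZHat, reduction n x = 1 ∧ psi d h2 (reduction M x).1 = -1 := by
  obtain ⟨M, hM0⟩ := M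
  simp only [PNat.mk_coe] at hM hMn h2
  subst hM
  by_cases hn2 : 2 ∣ (n : ℕ)
  · obtain ⟨D, hDn, hDM, hD⟩ :
        ∃ D : ℕ, D ≡ 1 [MOD n] ∧ D.Coprime (q * W) ∧ χ D * jacobiSym D W = -1 := by
      by_cases hqn : q ∣ (n : ℕ)
      · exact S.exists_nontrivial_of_not_W_dvd hd fun hWn =>
          hMn (S.coprime.mul_dvd_of_dvd_of_dvd hqn hWn)
      · exact S.exists_nontrivial_of_not_q_dvd hn2 hqn
    have hDn' : D.Coprime n := (hDn.gcd_eq).trans (Nat.gcd_one_left _)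
    -- A common multiple of n and M, so that a single lift controls both reductions.
    let N : ℕ+ := n * ⟨q * W, hM0⟩
    have hdet : IsUnit (!![1, 0; 0, (D : ZMod N)] : Mat N).det := by
      rw [Matrix.det_fin_two_of, one_mul, zero_mul, sub_zero]
      exact (ZMod.isUnit_iff_coprime _ _).mpr (hDn'.mul_right hDM)
    obtain ⟨x, hx⟩ := reduction_surjective N (Matrix.GeneralLinearGroup.mk'' _ hdet)
    have hred (k : ℕ+) (hk : (k : ℕ) ∣ N) :
        (reduction k x).1 = !![1, 0; 0, (D : ZMod k)] := by
      rw [← map_castHom_reduction hk, hx]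
      ext i j
      change ZMod.castHom hk (ZMod k) (!![1, 0; 0, (D : ZMod N)] i j) = _
      fin_cases i <;> fin_cases j <;> simp [-ZMod.castHom_apply]
    refine ⟨x, Units.ext ?_, ?_⟩
    · rw [hred n (Dvd.intro _ rfl), (ZMod.natCast_eq_natCast_iff D 1 n).mpr hDn, Nat.cast_one]
      exact Matrix.one_fin_two.symm
    · rw [hred _ (Dvd.intro_left _ rfl)]
      exact (S.psi_diag h2 hDM).trans hD
  · let x : GL (Fin 2) ZHat := ⟨!![1, (n : ℕ); 0, 1], !![1, -((n : ℕ) : ZHat); 0, 1],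
      by simp [Matrix.one_fin_two], by simp [Matrix.one_fin_two]⟩
    have hred (k : ℕ+) : (reduction k x).1 = !![1, ((n : ℕ) : ZMod k); 0, 1] := by
      ext i j
      change ZHat.proj k (!![1, ((n : ℕ) : ZHat); 0, 1] i j) = _
      fin_cases i <;> fin_cases j <;> simp
    refine ⟨x, Units.ext ?_, ?_⟩
    · rw [hred n, ZMod.natCast_self]
      exact Matrix.one_fin_two.symm
    · refine (congrArg (psi d h2) (hred ⟨q * W, hM0⟩)).trans ?_
      refine (S.psi_of_det_eq_one h2 !![1, ((n : ℕ) : ZMod (q * W)); 0, 1]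
        (by simp)).trans ?_
      have h1 : ((n : ℕ) : ZMod 2) = 1 := by
        rw [ZMod.natCast_eq_one_iff_odd]
        exact Nat.not_even_iff_odd.mp fun he => hn2 he.two_dvd
      have : reduceMat h2 !![1, ((n : ℕ) : ZMod (q * W)); 0, 1] = !![1, 1; 0, 1] := by
        ext i j
        fin_cases i <;> fin_cases j <;> simp [reduceMat, h1, -ZMod.castHom_apply]
      exact (congrArg signTwo this).trans (by decide)

end Splitting

end SerreCurve

namespace SerreCurve

/-! ### The image of the torsion representation of a Serre curve -/

theorem natCast_card_subtype {n : ℕ} [NeZero n] {P : GL (Fin 2) (ZMod n) → Prop} {f : Mat n → ℤ}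
    [DecidablePred P] (hf : ∀ g : GL (Fin 2) (ZMod n), f g.1 = if P g then 1 else 0) :
    (Nat.card {g // P g} : ℤ) = glSum n f := by
  rw [glSum, finsum_congr hf, finsum_eq_sum_of_fintype, Nat.card_eq_fintype_card,
    Fintype.card_subtype, Finset.sum_boole]

theorem natCast_card_gl (n : ℕ) [NeZero n] :
    (Nat.card (GL (Fin 2) (ZMod n)) : ℤ) = glSum n fun _ => 1 := by
  rw [glSum, finsum_eq_sum_of_fintype, Nat.card_eq_fintype_card]
  simp

theorem natCast_traceCount_top (n : ℕ+) (r : ℤ) :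
    (traceCount (⊤ : Subgroup (GL (Fin 2) (ZMod n))) r : ℤ) = glSum n (traceInd r n) := by
  classical
  exact natCast_card_subtype fun g => by simp [traceInd]

theorem natCast_koblitzCount_top (n : ℕ+) :
    (koblitzCount (⊤ : Subgroup (GL (Fin 2) (ZMod n))) : ℤ) = glSum n (koblitzInd n) := by
  classical
  exact natCast_card_subtype fun g => by simp [koblitzInd]

variable {d : ℤ} {h q W : ℕ} {χ : ZMod q →* ℤ}

/-- The character `ε(·) (d / det(·))` of `GL₂(ℤ/nℤ)`. -/
def Splitting.psiHom (S : Splitting d h q W χ) {n : ℕ} (hn : n = q * W) (h2 : 2 ∣ n) :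
    GL (Fin 2) (ZMod n) →* ℤˣ :=
  MonoidHom.toHomUnits
    { toFun := fun g => psi d h2 g.1
      map_one' := by subst hn; exact S.psi_one h2
      map_mul' := fun g g' => by
        subst hn; exact S.psi_mul h2 g.1 g'.1 (isUnit_det g) (isUnit_det g') }

theorem Splitting.coe_psiHom (S : Splitting d h q W χ) {n : ℕ} (hn : n = q * W) (h2 : 2 ∣ n)
    (g : GL (Fin 2) (ZMod n)) : (S.psiHom hn h2 g : ℤ) = psi d h2 g.1 := rfl

theorem Splitting.psiHom_eq_one_iff (S : Splitting d h q W χ) {n : ℕ} (hn : n = q * W)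
    (h2 : 2 ∣ n) (g : GL (Fin 2) (ZMod n)) : S.psiHom hn h2 g = 1 ↔ psi d h2 g.1 = 1 := by
  rw [← S.coe_psiHom hn, Units.val_eq_one]

/-- Twice the indicator function of the kernel is 1 + ψ. -/
theorem Splitting.two_mul_card_ker_subtype (S : Splitting d h q W χ) {n : ℕ} [NeZero n]
    (hn : n = q * W) (h2 : 2 ∣ n) {P : GL (Fin 2) (ZMod n) → Prop} {f : Mat n → ℤ}
    [DecidablePred P] (hf : ∀ g : GL (Fin 2) (ZMod n), f g.1 = if P g then 1 else 0) :
    2 * (Nat.card {g // g ∈ (S.psiHom hn h2).ker ∧ P g} : ℤ) =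
      glSum n f + glSum n fun A => f A * psi d h2 A := by
  rw [Nat.card_eq_fintype_card, Fintype.card_subtype, ← Finset.sum_boole, Finset.mul_sum, glSum,
    glSum, finsum_eq_sum_of_fintype, finsum_eq_sum_of_fintype, ← Finset.sum_add_distrib]
  refine Finset.sum_congr rfl fun g _ => ?_
  rw [hf, ← S.coe_psiHom hn]
  rcases Int.units_eq_one_or (S.psiHom hn h2 g) with h1 | h1 <;> by_cases hP : P g <;>
    simp [MonoidHom.mem_ker, h1, hP]

theorem two_mul_card_ker {G : Type*} [Group G] [Finite G] (f : G →* ℤˣ) {g : G} (hg : f g = -1) :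
    2 * Nat.card f.ker = Nat.card G := by
  rw [← Subgroup.card_mul_index f.ker, Subgroup.index_ker, mul_comm]
  congr 1
  have hr : f.range = ⊤ := by
    rw [eq_top_iff]
    intro u _
    rcases Int.units_eq_one_or u with rfl | rfl
    · exact one_mem _
    · exact ⟨g, hg⟩
  rw [hr, Subgroup.card_top, Nat.card_eq_fintype_card]
  rfl

variable {E : WeierstrassCurve ℚ} [E.IsElliptic]

theorem serreLevel_eq (S : Splitting (sfDisc E) h q W χ) : (serreLevel E : ℕ) = q * W := S.level

/-- The character of `GL₂(Ẑ)` whose kernel is `H_E`. -/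
def adelicChar (S : Splitting (sfDisc E) h q W χ) : GL (Fin 2) ZHat →* ℤˣ :=
  (S.psiHom (serreLevel_eq S) (two_dvd_serreLevel E)).comp (reduction (serreLevel E))

variable (S : Splitting (sfDisc E) h q W χ) (b : TorsionBasis E) (hE : IsSerreCurve E)

theorem mem_serreSubgroup_iff (x : GL (Fin 2) ZHat) :
    x ∈ serreSubgroup E ↔ adelicChar S x = 1 := by
  refine Iff.trans ?_ (S.psiHom_eq_one_iff (serreLevel_eq S) (two_dvd_serreLevel E) _).symm
  change epsilon _ _ * _ = 1 ↔ _
  rw [epsilon, sign_permOfGL]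
  rfl

include S hE

/-- A character with values in a commutative group is invariant under conjugation, so its kernel is
the image for every basis once it is for one. -/
theorem range_adelicRep : (adelicRep b).range = (adelicChar S).ker := by
  obtain ⟨b₀, hb₀⟩ := hE
  have hmem (x : GL (Fin 2) ZHat) : x ∈ (adelicRep b₀).range ↔ adelicChar S x = 1 := by
    rw [← mem_serreSubgroup_iff, ← hb₀]
    rfl
  obtain ⟨u, hu⟩ := exists_conj_adelicRep b₀ b
  have hconj (x : GL (Fin 2) ZHat) : adelicChar S (u * x * u⁻¹) = adelicChar S x := by
    rw [map_mul, map_mul, map_inv, mul_inv_cancel_comm]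
  ext x
  rw [MonoidHom.mem_ker]
  constructor
  · rintro ⟨σ, rfl⟩
    rw [hu, hconj, ← hmem]
    exact ⟨σ, rfl⟩
  · intro hx
    have hx' : adelicChar S (u⁻¹ * x * u) = 1 := by
      rw [← hconj, show u * (u⁻¹ * x * u) * u⁻¹ = x by group, hx]
    obtain ⟨σ, hσ⟩ := (hmem _).mpr hx'
    exact ⟨σ, by rw [hu, hσ]; group⟩

theorem galImage_eq_map (n : ℕ+) : galImage b n = (adelicChar S).ker.map (reduction n) := by
  rw [← range_adelicRep S b hE, galImage, MonoidHom.map_range]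
  rfl

/-- A lift with ψ = -1 is corrected by a factor that has ψ = -1 and is trivial modulo n. -/
theorem galImage_eq_top {n : ℕ+} (hn : ¬ (serreLevel E : ℕ) ∣ n) : galImage b n = ⊤ := by
  obtain ⟨x, hx1, hx2⟩ := S.exists_psi_eq_neg_one (sfDisc_squarefree E) (serreLevel_eq S)
    (two_dvd_serreLevel E) hn
  have hx : adelicChar S x = -1 := Units.ext hx2
  rw [galImage_eq_map S b hE, eq_top_iff]
  intro g _
  obtain ⟨y, rfl⟩ := reduction_surjective n g
  rcases Int.units_eq_one_or (adelicChar S y) with hy | hy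
  · exact ⟨y, hy, rfl⟩
  · refine ⟨y * x, ?_, by rw [map_mul, hx1, mul_one]⟩
    change adelicChar S (y * x) = 1
    rw [map_mul, hy, hx]
    rfl

theorem galImage_eq_ker {n : ℕ+} (hn : (serreLevel E : ℕ) ∣ n) :
    galImage b n = ((S.psiHom (serreLevel_eq S) (two_dvd_serreLevel E)).comp
      (Matrix.GeneralLinearGroup.map (ZMod.castHom hn (ZMod (serreLevel E))))).ker := by
  have key (x : GL (Fin 2) ZHat) : (S.psiHom (serreLevel_eq S) (two_dvd_serreLevel E)).comp
      (Matrix.GeneralLinearGroup.map (ZMod.castHom hn (ZMod (serreLevel E)))) (reduction n x) =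
      adelicChar S x := by
    rw [MonoidHom.comp_apply, map_castHom_reduction hn]
    rfl
  rw [galImage_eq_map S b hE]
  ext g
  rw [MonoidHom.mem_ker]
  constructor
  · rintro ⟨x, hx, rfl⟩
    rw [key]
    exact hx
  · intro hg
    obtain ⟨x, rfl⟩ := reduction_surjective n g
    exact ⟨x, (key x).symm.trans hg, rfl⟩

theorem galImage_serreLevel :
    galImage b (serreLevel E) = (S.psiHom (serreLevel_eq S) (two_dvd_serreLevel E)).ker := by
  rw [galImage_eq_ker S b hE dvd_rfl, ZMod.castHom_self, Matrix.GeneralLinearGroup.map_id]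
  rfl

theorem two_mul_card_galImage {n : ℕ+} (hn : (serreLevel E : ℕ) ∣ n) :
    2 * Nat.card (galImage b n) = Nat.card (GL (Fin 2) (ZMod n)) := by
  -- The conductor statement at modulus 1 simply says that ψ is non-trivial.
  have h1 : ¬ (serreLevel E : ℕ) ∣ (1 : ℕ+) := fun h1 =>
    absurd ((two_dvd_serreLevel E).trans h1) (by norm_num)
  obtain ⟨x, -, hx⟩ := S.exists_psi_eq_neg_one (sfDisc_squarefree E) (serreLevel_eq S)
    (two_dvd_serreLevel E) h1
  rw [galImage_eq_ker S b hE hn]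
  refine two_mul_card_ker _ (g := reduction n x) ?_
  rw [MonoidHom.comp_apply, map_castHom_reduction hn]
  exact Units.ext hx

theorem isLevel_serreLevel : IsLevel b (serreLevel E) := by
  rw [IsLevel, range_adelicRep S b hE, galImage_serreLevel S b hE]
  rfl

theorem serreLevel_dvd_of_isLevel {m : ℕ+} (hm : IsLevel b m) : (serreLevel E : ℕ) ∣ m := by
  by_contra hn
  obtain ⟨x, hx1, hx2⟩ := S.exists_psi_eq_neg_one (sfDisc_squarefree E) (serreLevel_eq S)
    (two_dvd_serreLevel E) hn
  have hx : x ∈ (adelicRep b).range := by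
    rw [hm, Subgroup.mem_comap, hx1]
    exact one_mem _
  rw [range_adelicRep S b hE, MonoidHom.mem_ker] at hx
  have : (adelicChar S x : ℤ) = -1 := hx2
  rw [hx] at this
  exact absurd this (by norm_num)

theorem minLevel_eq : minLevel b = serreLevel E := by
  classical
  have hex : ∃ m, IsLevel b m := ⟨_, isLevel_serreLevel S b hE⟩
  rw [minLevel, dif_pos hex]
  refine le_antisymm (PNat.find_min' _ (isLevel_serreLevel S b hE)) ?_
  exact Nat.le_of_dvd (PNat.pos _) (serreLevel_dvd_of_isLevel S b hE (PNat.find_spec hex))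

theorem two_mul_traceCount (r : ℤ) :
    2 * (traceCount (galImage b (serreLevel E)) r : ℤ) =
      glSum (serreLevel E) (traceInd r (serreLevel E)) +
        glSum (serreLevel E) fun A =>
          traceInd r (serreLevel E) A * psi (sfDisc E) (two_dvd_serreLevel E) A := by
  rw [galImage_serreLevel S b hE]
  exact S.two_mul_card_ker_subtype (serreLevel_eq S) (two_dvd_serreLevel E) fun g => rfl

theorem two_mul_koblitzCount :
    2 * (koblitzCount (galImage b (serreLevel E)) : ℤ) =
      glSum (serreLevel E) (koblitzInd (serreLevel E)) +
        glSum (serreLevel E) fun A =>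
          koblitzInd (serreLevel E) A * psi (sfDisc E) (two_dvd_serreLevel E) A := by
  classical
  rw [galImage_serreLevel S b hE]
  exact S.two_mul_card_ker_subtype (serreLevel_eq S) (two_dvd_serreLevel E) fun g => by
    simp [koblitzInd]

end SerreCurve

namespace SerreCurve

/-! ### The Euler factors -/

section Factors

variable (l : Nat.Primes)

instance fact_prime_coe : Fact (l : ℕ).Prime := ⟨l.2⟩

theorem two_le_prime : (2 : ℝ) ≤ l := by exact_mod_cast l.2.two_le

theorem card_gl_prime :
    (Nat.card (GL (Fin 2) (ZMod l)) : ℝ) = (l : ℝ) * ((l : ℝ) - 1) ^ 2 * (l + 1) := by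
  have := (natCast_card_gl l).trans (glSum_one_prime l)
  exact_mod_cast congrArg (Int.cast : ℤ → ℝ) this

theorem traceCount_prime (r : ℤ) :
    (traceCount (n := primePos l) ⊤ r : ℝ) =
      if ((l : ℕ) : ℤ) ∣ r then (l : ℝ) ^ 3 - (l : ℝ) ^ 2 else (l : ℝ) ^ 3 - (l : ℝ) ^ 2 - l := by
  have h := (natCast_traceCount_top (primePos l) r).trans (glSum_traceInd_prime l r)
  rw [← Int.cast_natCast (R := ℝ), h]
  simp only [← ZMod.intCast_zmod_eq_zero_iff_dvd]
  split_ifs <;> push_cast <;> rfl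

theorem koblitzCount_prime :
    (koblitzCount (n := primePos l) ⊤ : ℝ) =
      (l : ℝ) * ((l : ℝ) ^ 3 - 2 * (l : ℝ) ^ 2 - l + 3) := by
  have h := (natCast_koblitzCount_top (primePos l)).trans (glSum_koblitzInd_prime l)
  exact_mod_cast congrArg (Int.cast : ℤ → ℝ) h

theorem langTrotterFactor_eq (r : ℤ) : langTrotterFactor r l = avgLangTrotterFactor r l := by
  have hl := two_le_prime l
  have h1 : (l : ℝ) - 1 ≠ 0 := by linarith
  have h2 : (l : ℝ) + 1 ≠ 0 := by linarith
  have h0 : (l : ℝ) ≠ 0 := by linarith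
  have h3 : (l : ℝ) ^ 2 - 1 = (l - 1) * (l + 1) := by ring
  rw [langTrotterFactor, avgLangTrotterFactor, traceCount_prime]
  change _ / (Nat.card (GL (Fin 2) (ZMod l)) : ℝ) = _
  rw [card_gl_prime, h3]
  split_ifs <;> field_simp <;> ring

theorem koblitzFactor_eq : koblitzFactor l = avgKoblitzFactor l := by
  have hl := two_le_prime l
  have h1 : (l : ℝ) - 1 ≠ 0 := by linarith
  have h2 : (l : ℝ) + 1 ≠ 0 := by linarith
  have h0 : (l : ℝ) ≠ 0 := by linarith
  rw [koblitzFactor, avgKoblitzFactor, koblitzCount_prime]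
  change _ / (Nat.card (GL (Fin 2) (ZMod l)) : ℝ) / _ = _
  rw [card_gl_prime, one_sub_div h0]
  field_simp
  ring

theorem avgCyclicFactor_eq :
    avgCyclicFactor l = 1 - 1 / (Nat.card (GL (Fin 2) (ZMod l)) : ℝ) := by
  rw [avgCyclicFactor, card_gl_prime]

end Factors

/-! ### Convergence -/

theorem summable_of_norm_le_primes {f : Nat.Primes → ℝ} {C : ℝ}
    (hf : ∀ l, |f l| ≤ C * (1 / (l : ℝ) ^ 2)) : Summable f := by
  refine Summable.of_norm_bounded ?_ hf
  exact ((Real.summable_one_div_nat_pow.mpr one_lt_two).comp_injective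
    Nat.Primes.coe_nat_injective).mul_left C

theorem summable_avgLangTrotter (r : ℤ) : Summable fun l => avgLangTrotterFactor r l - 1 := by
  refine summable_of_norm_le_primes (C := 2) fun l => ?_
  have hl := two_le_prime l
  have h2 : 0 < (l : ℝ) ^ 2 - 1 := by nlinarith
  have h3 : 1 / ((l : ℝ) ^ 2 - 1) ≤ 2 * (1 / (l : ℝ) ^ 2) := by
    rw [mul_one_div, div_le_div_iff₀ h2 (by positivity)]
    nlinarith
  rw [avgLangTrotterFactor]
  split_ifs
  · rw [add_sub_cancel_left, abs_of_nonneg (one_div_nonneg.mpr h2.le)]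
    exact h3
  · rw [sub_sub_cancel_left, abs_neg, abs_of_nonneg (by
      apply div_nonneg zero_le_one (mul_nonneg (by linarith) h2.le))]
    refine le_trans (one_div_le_one_div_of_le h2 ?_) h3
    nlinarith

theorem summable_avgKoblitz : Summable fun l => avgKoblitzFactor l - 1 := by
  refine summable_of_norm_le_primes (C := 8) fun l => ?_
  have hl := two_le_prime l
  have h1 : 0 < (l : ℝ) ^ 2 - l - 1 := by nlinarith
  have h2 : 0 < ((l : ℝ) - 1) ^ 3 * (l + 1) := by
    have : 0 < (l : ℝ) - 1 := by linarith
    positivity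
  rw [avgKoblitzFactor, sub_sub_cancel_left, abs_neg, abs_of_pos (div_pos h1 h2), mul_one_div,
    div_le_div_iff₀ h2 (by positivity)]
  -- The bound l - 1 ≥ l/2 makes the denominator at least l⁴/8, whence the constant 8.
  have h3 : (l : ℝ) / 2 ≤ l - 1 := by linarith
  have h4 : ((l : ℝ) / 2) ^ 3 ≤ (l - 1) ^ 3 := pow_le_pow_left₀ (by linarith) h3 3
  have h5 : ((l : ℝ) / 2) ^ 3 * l ≤ ((l : ℝ) - 1) ^ 3 * (l + 1) :=
    mul_le_mul h4 (by linarith) (by linarith) (pow_nonneg (by linarith) 3)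
  nlinarith [mul_nonneg (sq_nonneg (l : ℝ)) (by linarith : (0 : ℝ) ≤ l + 1)]

theorem summable_avgCyclic : Summable fun l => avgCyclicFactor l - 1 := by
  refine summable_of_norm_le_primes (C := 1) fun l => ?_
  have hl := two_le_prime l
  have h1 : 1 ≤ ((l : ℝ) - 1) ^ 2 := by nlinarith
  have h0 : 0 ≤ (l : ℝ) * (l - 1) ^ 2 * (l + 1) :=
    mul_nonneg (mul_nonneg (by linarith) (sq_nonneg _)) (by linarith)
  rw [avgCyclicFactor, sub_sub_cancel_left, abs_neg, abs_of_nonneg (one_div_nonneg.mpr h0), one_mul]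
  refine one_div_le_one_div_of_le (pow_pos (by linarith) 2) ?_
  nlinarith [mul_le_mul_of_nonneg_left h1 (mul_nonneg (by linarith) (by linarith) : (0 : ℝ) ≤ l * (l + 1))]

theorem multipliable_of_summable_sub_one {ι : Type*} {f : ι → ℝ}
    (h : Summable fun i => f i - 1) : Multipliable f := by
  simpa using multipliable_one_add_of_summable h.norm

theorem multipliable_subtype {f : Nat.Primes → ℝ} (h : Summable fun i => f i - 1)
    (s : Nat.Primes → Prop) : Multipliable fun l : {l // s l} => f l :=
  multipliable_of_summable_sub_one (h.comp_injective Subtype.val_injective)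

theorem tprod_primes_eq {f : Nat.Primes → ℝ} (hf : Summable fun i => f i - 1) {F : ℕ → ℝ}
    (hF : ∀ l : Nat.Primes, f l = F l) {M : ℕ} (hM : M ≠ 0) :
    ∏' l, f l = (∏ l ∈ M.primeFactors, F l) * ∏' l : {l : Nat.Primes // ¬ (l : ℕ) ∣ M}, f l := by
  rw [← Multipliable.tprod_mul_tprod_compl (s := {l : Nat.Primes | (l : ℕ) ∣ M})
    (multipliable_subtype hf _) (multipliable_subtype hf _)]
  congr 1
  rw [← Finset.tprod_subtype M.primeFactors F]
  let e : {l : Nat.Primes // (l : ℕ) ∣ M} ≃ {p // p ∈ M.primeFactors} :=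
    { toFun := fun l => ⟨l.1, Nat.mem_primeFactors.mpr ⟨l.1.2, l.2, hM⟩⟩
      invFun := fun p => ⟨⟨p.1, Nat.prime_of_mem_primeFactors p.2⟩,
        Nat.dvd_of_mem_primeFactors p.2⟩
      left_inv := fun _ => rfl
      right_inv := fun _ => rfl }
  rw [← e.tprod_eq]
  exact tprod_congr fun l => hF l.1

/-! ### The series `∑ μ(n) / |GL₂(ℤ/nℤ)|` -/

/-- The matrices with rows (1 + xy, x) and (y, 1) have determinant 1 and are distinct. This crude
bound already dominates the Möbius series by ∑ 1/n². -/
theorem sq_le_card_gl (n : ℕ) [NeZero n] : n ^ 2 ≤ Nat.card (GL (Fin 2) (ZMod n)) := by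
  let f : ZMod n × ZMod n → GL (Fin 2) (ZMod n) := fun p =>
    ⟨!![1 + p.1 * p.2, p.1; p.2, 1], !![1, -p.1; -p.2, 1 + p.1 * p.2],
      by simp [Matrix.one_fin_two, mul_comm], by simp [Matrix.one_fin_two, mul_comm]⟩
  have hf : Function.Injective f := fun p p' h => by
    have h' : (f p).1 = (f p').1 := congrArg Units.val h
    exact Prod.ext (congrFun (congrFun h' 0) 1) (congrFun (congrFun h' 1) 0)
  have := Nat.card_le_card_of_injective f hf
  rwa [Nat.card_prod, Nat.card_zmod, ← sq] at this

theorem card_gl_mul {m n : ℕ} [NeZero m] [NeZero n] (h : m.Coprime n) :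
    Nat.card (GL (Fin 2) (ZMod (m * n))) =
      Nat.card (GL (Fin 2) (ZMod m)) * Nat.card (GL (Fin 2) (ZMod n)) := by
  have := glSum_mul h (fun _ => 1) (fun _ => 1)
  simp only [mul_one, ← natCast_card_gl] at this
  exact_mod_cast this

/-- The function `μ(n) / |GL₂(ℤ/nℤ)|`. -/
def moebiusTerm (n : ℕ) : ℝ :=
  (ArithmeticFunction.moebius n : ℝ) / Nat.card (GL (Fin 2) (ZMod n))

theorem moebiusTerm_zero : moebiusTerm 0 = 0 := by simp [moebiusTerm]

theorem moebiusTerm_one : moebiusTerm 1 = 1 := by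
  have := natCast_card_gl 1
  rw [glSum_one_modulus _ fun _ => rfl] at this
  rw [moebiusTerm, ArithmeticFunction.moebius_apply_one,
    show Nat.card (GL (Fin 2) (ZMod 1)) = 1 by exact_mod_cast this]
  norm_num

theorem moebiusTerm_mul {m n : ℕ} (h : m.Coprime n) :
    moebiusTerm (m * n) = moebiusTerm m * moebiusTerm n := by
  rcases Nat.eq_zero_or_pos m with rfl | hm
  · simp [moebiusTerm_zero]
  rcases Nat.eq_zero_or_pos n with rfl | hn
  · simp [moebiusTerm_zero]
  have : NeZero m := ⟨hm.ne'⟩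
  have : NeZero n := ⟨hn.ne'⟩
  rw [moebiusTerm, ArithmeticFunction.isMultiplicative_moebius.map_mul_of_coprime h,
    card_gl_mul h, moebiusTerm, moebiusTerm, div_mul_div_comm]
  push_cast
  rfl

theorem abs_moebiusTerm_le (n : ℕ) : |moebiusTerm n| ≤ 1 / (n : ℝ) ^ 2 := by
  rcases Nat.eq_zero_or_pos n with rfl | hn
  · simp [moebiusTerm_zero]
  have : NeZero n := ⟨hn.ne'⟩
  have h1 : |(ArithmeticFunction.moebius n : ℝ)| ≤ 1 := by
    exact_mod_cast ArithmeticFunction.abs_moebius_le_one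
  have h2 : (n : ℝ) ^ 2 ≤ Nat.card (GL (Fin 2) (ZMod n)) := by exact_mod_cast sq_le_card_gl n
  have hn' : (0 : ℝ) < n := by exact_mod_cast hn
  rw [moebiusTerm, abs_div, Nat.abs_cast]
  exact div_le_div₀ zero_le_one h1 (by positivity) h2

theorem summable_moebiusTerm : Summable fun n => ‖moebiusTerm n‖ :=
  Summable.of_nonneg_of_le (fun _ => norm_nonneg _) abs_moebiusTerm_le
    (Real.summable_one_div_nat_pow.mpr one_lt_two)

theorem moebiusTerm_prime_pow (l : Nat.Primes) {e : ℕ} (he : 2 ≤ e) :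
    moebiusTerm ((l : ℕ) ^ e) = 0 := by
  rw [moebiusTerm, ArithmeticFunction.moebius_apply_prime_pow l.2 (by omega), if_neg (by omega)]
  simp

theorem moebiusTerm_prime (l : Nat.Primes) :
    moebiusTerm l = -(1 / (Nat.card (GL (Fin 2) (ZMod l)) : ℝ)) := by
  rw [moebiusTerm, ArithmeticFunction.moebius_apply_prime l.2]
  push_cast
  ring

/-- The restriction of `μ(n) / |GL₂(ℤ/nℤ)|` to the integers coprime to `M`. -/
def moebiusTermAway (M n : ℕ) : ℝ := if n.Coprime M then moebiusTerm n else 0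

theorem abs_moebiusTermAway_le (M n : ℕ) : ‖moebiusTermAway M n‖ ≤ ‖moebiusTerm n‖ := by
  rw [moebiusTermAway]
  split_ifs
  · exact le_rfl
  · rw [norm_zero]
    exact norm_nonneg _

/-- Euler product of a multiplicative function that vanishes at squares of primes and beyond: each
local series has only the terms with exponent 0 and 1. -/
theorem tsum_moebiusTermAway (M : ℕ) :
    ∑' n, moebiusTermAway M n =
      ∏' l : Nat.Primes, if (l : ℕ) ∣ M then 1 else avgCyclicFactor l := by
  have h1 : moebiusTermAway M 1 = 1 := by
    rw [moebiusTermAway, if_pos (Nat.coprime_one_left M), moebiusTerm_one]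
  have h0 : moebiusTermAway M 0 = 0 := by
    rw [moebiusTermAway, moebiusTerm_zero, ite_self]
  rw [← (EulerProduct.eulerProduct_hasProd (f := moebiusTermAway M) h1 (fun {m n} h => ?_)
    (Summable.of_nonneg_of_le (fun _ => norm_nonneg _) (abs_moebiusTermAway_le M)
      summable_moebiusTerm) h0).tprod_eq]
  · refine tprod_congr fun l => ?_
    rw [tsum_eq_sum (s := Finset.range 2), Finset.sum_range_succ, Finset.sum_range_one, pow_zero,
      pow_one, h1, moebiusTermAway, moebiusTerm_prime, avgCyclicFactor_eq]
    · simp only [l.2.coprime_iff_not_dvd]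
      split_ifs <;> ring
    · intro e he
      rw [moebiusTermAway, moebiusTerm_prime_pow l (not_lt.mp (Finset.mem_range.not.mp he)), ite_self]
  · simp only [moebiusTermAway, Nat.coprime_mul_iff_left, moebiusTerm_mul h, ite_and]
    split_ifs <;> simp

/-- If n is not coprime to M, then Mn is not square-free and μ(Mn) = 0. -/
theorem moebiusTerm_mul_left {M : ℕ} (n : ℕ) :
    moebiusTerm (M * n) = moebiusTerm M * moebiusTermAway M n := by
  rw [moebiusTermAway]
  split_ifs with h
  · exact moebiusTerm_mul h.symm
  · rw [moebiusTerm, ArithmeticFunction.moebius_eq_zero_of_not_squarefree]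
    · simp
    · exact fun hs => h (Nat.coprime_of_squarefree_mul hs).symm

theorem summable_ite_dvd_moebiusTerm (M : ℕ) :
    Summable fun n => if M ∣ n then moebiusTerm n else 0 := by
  refine Summable.of_norm_bounded summable_moebiusTerm fun n => ?_
  split_ifs
  · exact le_rfl
  · rw [norm_zero]
    exact norm_nonneg _

theorem tsum_ite_dvd_moebiusTerm (M : ℕ) (hM : M ≠ 0) :
    ∑' n, (if M ∣ n then moebiusTerm n else 0) =
      moebiusTerm M * ∑' n, moebiusTermAway M n := by
  have hinj : Function.Injective fun n : ℕ => M * n :=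
    fun _ _ h => Nat.eq_of_mul_eq_mul_left (Nat.pos_of_ne_zero hM) h
  rw [← tsum_mul_left, ← hinj.tsum_eq]
  · refine tsum_congr fun n => ?_
    rw [if_pos (Dvd.intro n rfl), moebiusTerm_mul_left]
  · intro n hn
    by_contra hn'
    refine hn (if_neg fun ⟨t, ht⟩ => hn' ⟨t, ht.symm⟩)

theorem cast_glSum_one (n : ℕ) [NeZero n] :
    ((glSum n fun _ => 1 : ℤ) : ℝ) = Nat.card (GL (Fin 2) (ZMod n)) := by
  rw [← natCast_card_gl, Int.cast_natCast]

/-- For square-free M, dividing 1/∏g by the missing Euler factors ∏(1 - 1/g), with g = |GL₂(ℤ/ℓℤ)|,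
gives 1/∏(g - 1). Otherwise μ(M) = 0 and both sides vanish. -/
theorem moebiusTerm_mul_tsum (M : ℕ) (hM : M ≠ 0) :
    moebiusTerm M * ∑' n, moebiusTermAway M n =
      avgCyclicConst * ((ArithmeticFunction.moebius M : ℝ) /
        ∏ l ∈ M.primeFactors, ((Nat.card (GL (Fin 2) (ZMod l)) : ℝ) - 1)) := by
  by_cases hsq : Squarefree M
  · have : NeZero M := ⟨hM⟩
    have hcard : (Nat.card (GL (Fin 2) (ZMod M)) : ℝ) =
        ∏ l ∈ M.primeFactors, (Nat.card (GL (Fin 2) (ZMod l)) : ℝ) := by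
      rw [← cast_glSum_one, IsLocal.const_one.glSum_eq_prod hsq, Int.cast_prod]
      refine Finset.prod_congr rfl fun p hp => ?_
      have : Fact p.Prime := ⟨Nat.prime_of_mem_primeFactors hp⟩
      exact cast_glSum_one p
    have hgt : ∀ l ∈ M.primeFactors, (1 : ℝ) < Nat.card (GL (Fin 2) (ZMod l)) := by
      intro l hl
      have hl' := Nat.prime_of_mem_primeFactors hl
      have : Fact l.Prime := ⟨hl'⟩
      have h1 := sq_le_card_gl l
      have h2 := hl'.two_le
      exact_mod_cast lt_of_lt_of_le (by nlinarith) h1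
    have hs : Summable fun l : Nat.Primes =>
        (if (l : ℕ) ∣ M then 1 else avgCyclicFactor l) - 1 := by
      refine Summable.of_norm_bounded summable_avgCyclic.norm fun l => ?_
      split_ifs
      · simp
      · exact le_rfl
    have h1 := tprod_primes_eq hs (F := fun l => if l ∣ M then 1 else
      1 - 1 / (Nat.card (GL (Fin 2) (ZMod l)) : ℝ))
      (fun l => by rw [avgCyclicFactor_eq]) hM
    have h2 := tprod_primes_eq summable_avgCyclic
      (F := fun l => 1 - 1 / (Nat.card (GL (Fin 2) (ZMod l)) : ℝ)) avgCyclicFactor_eq hM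
    rw [Finset.prod_eq_one fun l hl => if_pos (Nat.dvd_of_mem_primeFactors hl), one_mul,
      tprod_congr fun l : {l : Nat.Primes // ¬ (l : ℕ) ∣ M} => if_neg l.2] at h1
    rw [tsum_moebiusTermAway, avgCyclicConst, h1, h2, moebiusTerm, hcard]
    have h3 : ∏ l ∈ M.primeFactors, (1 - 1 / (Nat.card (GL (Fin 2) (ZMod l)) : ℝ)) =
        (∏ l ∈ M.primeFactors, ((Nat.card (GL (Fin 2) (ZMod l)) : ℝ) - 1)) /
          ∏ l ∈ M.primeFactors, (Nat.card (GL (Fin 2) (ZMod l)) : ℝ) := by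
      rw [← Finset.prod_div_distrib]
      refine Finset.prod_congr rfl fun l hl => ?_
      rw [one_sub_div (zero_lt_one.trans (hgt l hl)).ne']
    have h4 : ∏ l ∈ M.primeFactors, ((Nat.card (GL (Fin 2) (ZMod l)) : ℝ) - 1) ≠ 0 :=
      Finset.prod_ne_zero_iff.mpr fun l hl => (sub_pos.mpr (hgt l hl)).ne'
    rw [h3]
    field_simp
  · rw [moebiusTerm, ArithmeticFunction.moebius_eq_zero_of_not_squarefree hsq]
    simp

end SerreCurve

namespace SerreCurve

/-! ### Evaluation of the constants -/

/-- The Euler factor of `C_r` at the natural number `l`. -/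
def langTrotterEuler (r : ℤ) (l : ℕ) : ℝ :=
  if (l : ℤ) ∣ r then 1 + 1 / ((l : ℝ) ^ 2 - 1) else 1 - 1 / (((l : ℝ) - 1) * ((l : ℝ) ^ 2 - 1))

/-- The Euler factor of `C_prime` at the natural number `l`. -/
def koblitzEuler (l : ℕ) : ℝ :=
  1 - ((l : ℝ) ^ 2 - l - 1) / (((l : ℝ) - 1) ^ 3 * ((l : ℝ) + 1))

theorem langTrotterEuler_pos (r : ℤ) {l : ℕ} (hl : 2 ≤ l) : 0 < langTrotterEuler r l := by
  have hl' : (2 : ℝ) ≤ l := by exact_mod_cast hl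
  have h2 : 3 ≤ (l : ℝ) ^ 2 - 1 := by nlinarith
  rw [langTrotterEuler]
  split_ifs
  · have : 0 < (l : ℝ) ^ 2 - 1 := by linarith
    positivity
  · have h3 : 1 < ((l : ℝ) - 1) * ((l : ℝ) ^ 2 - 1) := by nlinarith
    rw [sub_pos, div_lt_one (by linarith)]
    exact h3

theorem card_gl_pos (n : ℕ) [NeZero n] : (0 : ℝ) < Nat.card (GL (Fin 2) (ZMod n)) := by
  exact_mod_cast Nat.card_pos

theorem glSum_traceInd_prime_eq (r : ℤ) {p : ℕ} (hp : p.Prime) :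
    (p : ℝ) * (glSum p (traceInd r p) : ℝ) =
      langTrotterEuler r p * ((glSum p fun _ => 1 : ℤ) : ℝ) := by
  have : Fact p.Prime := ⟨hp⟩
  have h : (p : ℝ) * traceCount (n := primePos ⟨p, hp⟩) ⊤ r /
      Nat.card (GL (Fin 2) (ZMod p)) = langTrotterEuler r p := langTrotterFactor_eq ⟨p, hp⟩ r
  rw [← Int.cast_natCast (R := ℝ) (traceCount _ _),
    natCast_traceCount_top] at h
  rw [cast_glSum_one, ← div_eq_iff (card_gl_pos p).ne']
  exact h

theorem one_sub_one_div_ne_zero {p : ℕ} (hp : p.Prime) : (1 : ℝ) - 1 / (p : ℝ) ≠ 0 := by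
  have : (1 : ℝ) < p := by exact_mod_cast hp.one_lt
  rw [sub_ne_zero, ne_eq, eq_comm, div_eq_one_iff_eq (by linarith)]
  linarith

theorem glSum_koblitzInd_prime_eq {p : ℕ} (hp : p.Prime) :
    (glSum p (koblitzInd p) : ℝ) =
      (1 - 1 / (p : ℝ)) * koblitzEuler p * ((glSum p fun _ => 1 : ℤ) : ℝ) := by
  have : Fact p.Prime := ⟨hp⟩
  have h : ((koblitzCount (n := primePos ⟨p, hp⟩) ⊤ : ℝ) / Nat.card (GL (Fin 2) (ZMod p))) /
      (1 - 1 / (p : ℝ)) = koblitzEuler p := koblitzFactor_eq ⟨p, hp⟩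
  have hp' := one_sub_one_div_ne_zero hp
  rw [← Int.cast_natCast (R := ℝ) (koblitzCount _), natCast_koblitzCount_top] at h
  rw [cast_glSum_one, mul_comm (1 - 1 / (p : ℝ)), ← div_eq_iff (card_gl_pos p).ne',
    ← div_eq_iff hp']
  exact h

theorem koblitz_polynomial_pos {p : ℕ} (hp : p.Prime) :
    (0 : ℝ) < (p : ℝ) ^ 3 - 2 * (p : ℝ) ^ 2 - p + 3 := by
  have h : (2 : ℝ) ≤ p := by exact_mod_cast hp.two_le
  nlinarith [mul_nonneg (by linarith : (0 : ℝ) ≤ p - 2) (by nlinarith : (0 : ℝ) ≤ (p : ℝ) ^ 2 - 1)]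

theorem koblitzEuler_pos {p : ℕ} (hp : p.Prime) : 0 < koblitzEuler p := by
  have h : (2 : ℝ) ≤ p := by exact_mod_cast hp.two_le
  have h1 : (p : ℝ) - 1 ≠ 0 := by linarith
  have h2 : (p : ℝ) + 1 ≠ 0 := by linarith
  have h3 : 0 < (p : ℝ) - 1 := by linarith
  have h4 : koblitzEuler p = p * ((p : ℝ) ^ 3 - 2 * (p : ℝ) ^ 2 - p + 3) /
      (((p : ℝ) - 1) ^ 3 * ((p : ℝ) + 1)) := by
    rw [koblitzEuler]
    field_simp
    ring
  rw [h4]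
  exact div_pos (mul_pos (by linarith) (koblitz_polynomial_pos hp)) (by positivity)

namespace Splitting

variable {d : ℤ} {h q W : ℕ} {χ : ZMod q →* ℤ} (S : Splitting d h q W χ)
include S

theorem prod_primeFactors (f : ℕ → ℝ) :
    ∏ l ∈ (q * W).primeFactors, f l = f 2 * ∏ p ∈ W.primeFactors, f p := by
  rw [S.primeFactors_mul, Finset.prod_insert S.two_notMem]

/-- Although q may be 4 or 8, the 2-part gives the ordinary Euler factor at 2: the count of trace r
has q³ where the group order has q⁴, and the extra factor q compensates. -/
theorem glSum_traceInd_eq (hd : Squarefree d) (r : ℤ) :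
    ((q * W : ℕ) : ℝ) * (glSum (q * W) (traceInd r (q * W)) : ℝ) =
      (∏ l ∈ (q * W).primeFactors, langTrotterEuler r l) *
        ((glSum (q * W) fun _ => 1 : ℤ) : ℝ) := by
  have hW : ∏ p ∈ W.primeFactors, (p : ℝ) = W := by
    rw [← Nat.cast_prod, Nat.prod_primeFactors_of_squarefree (S.W_squarefree hd)]
  have h1 : (∏ p ∈ W.primeFactors, (p : ℝ)) *
      ∏ p ∈ W.primeFactors, (glSum p (traceInd r p) : ℝ) =
      (∏ p ∈ W.primeFactors, langTrotterEuler r p) *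
        ∏ p ∈ W.primeFactors, ((glSum p fun _ => 1 : ℤ) : ℝ) := by
    rw [← Finset.prod_mul_distrib, ← Finset.prod_mul_distrib]
    exact Finset.prod_congr rfl fun p hp =>
      glSum_traceInd_prime_eq r (Nat.prime_of_mem_primeFactors hp)
  have hc := congrArg (Int.cast : ℤ → ℝ) S.card
  have ht := congrArg (Int.cast : ℤ → ℝ) (S.traceCount r)
  push_cast at hc ht
  have h2 : (q : ℝ) * (glSum q (traceInd r q) : ℝ) =
      langTrotterEuler r 2 * ((glSum q fun _ => 1 : ℤ) : ℝ) := by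
    rw [langTrotterEuler]
    simp only [← ZMod.intCast_zmod_eq_zero_iff_dvd]
    split_ifs at ht ⊢ <;> norm_num
    · linear_combination q / 8 * ht - 1 / 12 * hc
    · linear_combination q / 8 * ht - 1 / 24 * hc
  rw [S.glSum_local (isLocal_traceInd r) hd, S.glSum_local IsLocal.const_one hd,
    S.prod_primeFactors]
  push_cast
  rw [← hW]
  linear_combination (∏ p ∈ W.primeFactors, (p : ℝ)) *
    (∏ p ∈ W.primeFactors, (glSum p (traceInd r p) : ℝ)) * h2 +
      langTrotterEuler r 2 * ((glSum q fun _ => 1 : ℤ) : ℝ) * h1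

theorem glSum_koblitzInd_eq (hd : Squarefree d) :
    (glSum (q * W) (koblitzInd (q * W)) : ℝ) =
      (∏ l ∈ (q * W).primeFactors, (1 - 1 / (l : ℝ))) *
        (∏ l ∈ (q * W).primeFactors, koblitzEuler l) *
          ((glSum (q * W) fun _ => 1 : ℤ) : ℝ) := by
  have hc := congrArg (Int.cast : ℤ → ℝ) S.card
  have hk := congrArg (Int.cast : ℤ → ℝ) S.koblitzCount
  push_cast at hc hk
  have h2 : (glSum q (koblitzInd q) : ℝ) =
      (1 - 1 / ((2 : ℕ) : ℝ)) * koblitzEuler 2 * ((glSum q fun _ => 1 : ℤ) : ℝ) := by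
    rw [koblitzEuler]
    norm_num
    linear_combination 1 / 16 * hk - 1 / 48 * hc
  rw [S.glSum_local isLocal_koblitzInd hd, S.glSum_local IsLocal.const_one hd,
    S.prod_primeFactors, S.prod_primeFactors]
  push_cast
  rw [h2, Finset.prod_congr rfl fun p hp =>
    glSum_koblitzInd_prime_eq (Nat.prime_of_mem_primeFactors hp), Finset.prod_mul_distrib,
    Finset.prod_mul_distrib]
  push_cast
  ring

/-- Here q = 2. The sum of ψ is 2W = 2∏p and the plain count is 2∏ p(p³ - 2p² - p + 3), so their
ratio is the stated product. -/
theorem glSum_koblitzInd_psi_eq (hd : Squarefree d) (h1 : d % 4 = 1) (h2 : 2 ∣ q * W) :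
    ((glSum (q * W) fun A => koblitzInd (q * W) A * psi d h2 A : ℤ) : ℝ) =
      (glSum (q * W) (koblitzInd (q * W)) : ℝ) * ∏ p ∈ d.natAbs.primeFactors,
        1 / ((p : ℝ) ^ 3 - 2 * (p : ℝ) ^ 2 - (p : ℝ) + 3) := by
  have hq : q = 2 := by
    rw [S.q_eq_two_pow, twoExp, if_pos h1]
    norm_num
  have hdW : d.natAbs = W := by
    have := S.level
    rw [if_pos h1, hq] at this
    omega
  have hk := congrArg (Int.cast : ℤ → ℝ) S.koblitzCount
  push_cast at hk
  have hq2 : (q : ℝ) = 2 := by exact_mod_cast hq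
  have hq' : (glSum q (koblitzInd q) : ℝ) = 2 := by
    rw [hq2] at hk
    linarith
  have hW : ∏ p ∈ W.primeFactors, (p : ℝ) = W := by
    rw [← Nat.cast_prod, Nat.prod_primeFactors_of_squarefree (S.W_squarefree hd)]
  rw [S.glSum_koblitzInd_psi hd h2, if_pos h1, S.glSum_local isLocal_koblitzInd hd, hdW]
  push_cast
  rw [hq', mul_assoc, ← Finset.prod_mul_distrib, ← hW]
  congr 1
  refine Finset.prod_congr rfl fun p hp => ?_
  have hp' := Nat.prime_of_mem_primeFactors hp
  have : Fact p.Prime := ⟨hp'⟩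
  rw [glSum_koblitzInd_prime p]
  push_cast
  rw [mul_assoc, mul_one_div_cancel (koblitz_polynomial_pos hp').ne', mul_one]

end Splitting

variable {E : WeierstrassCurve ℚ} [E.IsElliptic] {h q W : ℕ} {χ : ZMod q →* ℤ}
  (S : Splitting (sfDisc E) h q W χ) (b : TorsionBasis E) (hE : IsSerreCurve E)

theorem moebius_serreLevel (h1 : ¬ sfDisc E % 4 = 1) :
    ArithmeticFunction.moebius (serreLevel E : ℕ) = 0 := by
  refine ArithmeticFunction.moebius_eq_zero_of_not_squarefree fun hs => ?_
  have h4 : (serreLevel E : ℕ) = 4 * (sfDisc E).natAbs := if_neg h1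
  rw [h4] at hs
  exact absurd (hs 2 (Dvd.intro _ rfl)) (by decide)

include S

theorem glSum_traceInd_psi_serreLevel (r : ℤ) :
    glSum (serreLevel E) (fun A => traceInd r (serreLevel E) A *
      psi (sfDisc E) (two_dvd_serreLevel E) A) =
      if (2 : ℤ) ^ (twoExp (sfDisc E) - 1) ∣ r then
        deltaSign (sfDisc E) r * ((serreLevel E : ℕ) * 2 ^ (twoExp (sfDisc E) - 1) *
          Nat.totient ((oddPart (sfDisc E)).gcd r.natAbs))
      else 0 := by
  -- The divisibility proof depends on the level, so it is generalized before the level is rewritten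
  -- as qW.
  generalize two_dvd_serreLevel E = h2
  revert h2
  rw [serreLevel_eq S]
  exact fun h2 => S.glSum_traceInd_psi (sfDisc_squarefree E) h2 r

theorem glSum_koblitzInd_psi_serreLevel (h1 : sfDisc E % 4 = 1) :
    ((glSum (serreLevel E) fun A => koblitzInd (serreLevel E) A *
      psi (sfDisc E) (two_dvd_serreLevel E) A : ℤ) : ℝ) =
      (glSum (serreLevel E) (koblitzInd (serreLevel E)) : ℝ) *
        ∏ p ∈ (sfDisc E).natAbs.primeFactors,
          1 / ((p : ℝ) ^ 3 - 2 * (p : ℝ) ^ 2 - (p : ℝ) + 3) := by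
  generalize two_dvd_serreLevel E = h2
  revert h2
  rw [serreLevel_eq S]
  exact fun h2 => S.glSum_koblitzInd_psi_eq (sfDisc_squarefree E) h1 h2

theorem glSum_koblitzInd_psi_serreLevel_eq_zero (h1 : ¬ sfDisc E % 4 = 1) :
    glSum (serreLevel E) (fun A => koblitzInd (serreLevel E) A *
      psi (sfDisc E) (two_dvd_serreLevel E) A) = 0 := by
  generalize two_dvd_serreLevel E = h2
  revert h2
  rw [serreLevel_eq S]
  exact fun h2 => (S.glSum_koblitzInd_psi (sfDisc_squarefree E) h2).trans (if_neg h1)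

theorem glSum_koblitzInd_serreLevel :
    (glSum (serreLevel E) (koblitzInd (serreLevel E)) : ℝ) =
      (∏ l ∈ (serreLevel E : ℕ).primeFactors, (1 - 1 / (l : ℝ))) *
        (∏ l ∈ (serreLevel E : ℕ).primeFactors, koblitzEuler l) *
          ((glSum (serreLevel E) fun _ => 1 : ℤ) : ℝ) := by
  rw [serreLevel_eq S]
  exact S.glSum_koblitzInd_eq (sfDisc_squarefree E)

theorem glSum_koblitzInd_serreLevel_ne_zero :
    (glSum (serreLevel E) (koblitzInd (serreLevel E)) : ℝ) ≠ 0 := by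
  rw [glSum_koblitzInd_serreLevel S, cast_glSum_one]
  refine mul_ne_zero (mul_ne_zero ?_ ?_) (card_gl_pos _).ne'
  · exact Finset.prod_ne_zero_iff.mpr fun l hl =>
      one_sub_one_div_ne_zero (Nat.prime_of_mem_primeFactors hl)
  · exact Finset.prod_ne_zero_iff.mpr fun l hl =>
      (koblitzEuler_pos (Nat.prime_of_mem_primeFactors hl)).ne'

include hE

theorem card_galImage_serreLevel :
    (Nat.card (galImage b (serreLevel E)) : ℝ) =
      ((glSum (serreLevel E) fun _ => 1 : ℤ) : ℝ) / 2 := by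
  rw [cast_glSum_one, ← two_mul_card_galImage S b hE dvd_rfl]
  push_cast
  ring

/-- The index two contributes a factor 2 that cancels the 1/2 in the indicator (1 + ψ)/2, and the
plain count supplies the Euler factors at the primes dividing the level. -/
theorem langTrotterConst_eq (r : ℤ) : langTrotterConst b r =
    avgLangTrotterConst r * (1 +
      ((glSum (serreLevel E) fun A => traceInd r (serreLevel E) A *
        psi (sfDisc E) (two_dvd_serreLevel E) A : ℤ) : ℝ) /
          (traceCount (⊤ : Subgroup (GL (Fin 2) (ZMod (serreLevel E)))) r : ℝ)) := by
  have hc := card_galImage_serreLevel S b hE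
  have ht := congrArg (Int.cast : ℤ → ℝ) (two_mul_traceCount S b hE r)
  have ht' := congrArg (Int.cast : ℤ → ℝ) (natCast_traceCount_top (serreLevel E) r)
  have hd : ((serreLevel E : ℕ) : ℝ) * (glSum (serreLevel E) (traceInd r (serreLevel E)) : ℝ) =
      (∏ l ∈ (serreLevel E : ℕ).primeFactors, langTrotterEuler r l) *
        ((glSum (serreLevel E) fun _ => 1 : ℤ) : ℝ) := by
    rw [serreLevel_eq S]
    exact S.glSum_traceInd_eq (sfDisc_squarefree E) r
  have hpos : 0 < ∏ l ∈ (serreLevel E : ℕ).primeFactors, langTrotterEuler r l :=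
    Finset.prod_pos fun l hl => langTrotterEuler_pos r (Nat.prime_of_mem_primeFactors hl).two_le
  have hG : 0 < ((glSum (serreLevel E) fun _ => 1 : ℤ) : ℝ) := by
    rw [cast_glSum_one]
    exact card_gl_pos _
  have ht0 : (glSum (serreLevel E) (traceInd r (serreLevel E)) : ℝ) ≠ 0 := by
    intro h0
    rw [h0, mul_zero] at hd
    exact (mul_pos hpos hG).ne hd
  push_cast at ht ht'
  rw [langTrotterConst, minLevel_eq S b hE, avgLangTrotterConst,
    tprod_primes_eq (summable_avgLangTrotter r) (F := langTrotterEuler r) (fun _ => rfl)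
      (serreLevel E).ne_zero, hc, ht']
  simp only [langTrotterFactor_eq]
  have key : ((serreLevel E : ℕ) : ℝ) * (traceCount (galImage b (serreLevel E)) r : ℝ) /
      (((glSum (serreLevel E) fun _ => 1 : ℤ) : ℝ) / 2) =
      (∏ l ∈ (serreLevel E : ℕ).primeFactors, langTrotterEuler r l) * (1 +
        ((glSum (serreLevel E) fun A => traceInd r (serreLevel E) A *
          psi (sfDisc E) (two_dvd_serreLevel E) A : ℤ) : ℝ) /
            (glSum (serreLevel E) (traceInd r (serreLevel E)) : ℝ)) := by
    rw [div_eq_iff (by positivity)]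
    field_simp
    linear_combination ((serreLevel E : ℕ) : ℝ) *
      (glSum (serreLevel E) (traceInd r (serreLevel E)) : ℝ) * ht + ((glSum (serreLevel E) (traceInd r (serreLevel E)) : ℝ) +
      (glSum (serreLevel E) fun A => traceInd r (serreLevel E) A *
        psi (sfDisc E) (two_dvd_serreLevel E) A : ℤ)) * hd
  rw [key]
  ring

theorem koblitzConst_eq : koblitzConst b =
    avgKoblitzConst * (1 +
      ((glSum (serreLevel E) fun A => koblitzInd (serreLevel E) A *
        psi (sfDisc E) (two_dvd_serreLevel E) A : ℤ) : ℝ) /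
          (glSum (serreLevel E) (koblitzInd (serreLevel E)) : ℝ)) := by
  have hc := card_galImage_serreLevel S b hE
  have hk := congrArg (Int.cast : ℤ → ℝ) (two_mul_koblitzCount S b hE)
  have hd := glSum_koblitzInd_serreLevel S
  have hpos : ∏ l ∈ (serreLevel E : ℕ).primeFactors, (1 - 1 / (l : ℝ)) ≠ 0 := by
    exact Finset.prod_ne_zero_iff.mpr fun l hl =>
      one_sub_one_div_ne_zero (Nat.prime_of_mem_primeFactors hl)
  have hG : 0 < ((glSum (serreLevel E) fun _ => 1 : ℤ) : ℝ) := by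
    rw [cast_glSum_one]
    exact card_gl_pos _
  have hk0 := glSum_koblitzInd_serreLevel_ne_zero S
  push_cast at hk
  rw [koblitzConst, minLevel_eq S b hE, avgKoblitzConst,
    tprod_primes_eq summable_avgKoblitz (F := koblitzEuler) (fun _ => rfl)
      (serreLevel E).ne_zero, hc]
  simp only [koblitzFactor_eq]
  have key : (koblitzCount (galImage b (serreLevel E)) : ℝ) /
      (((glSum (serreLevel E) fun _ => 1 : ℤ) : ℝ) / 2) /
        (∏ l ∈ (serreLevel E : ℕ).primeFactors, (1 - 1 / (l : ℝ))) =
      (∏ l ∈ (serreLevel E : ℕ).primeFactors, koblitzEuler l) * (1 +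
        ((glSum (serreLevel E) fun A => koblitzInd (serreLevel E) A *
          psi (sfDisc E) (two_dvd_serreLevel E) A : ℤ) : ℝ) /
            (glSum (serreLevel E) (koblitzInd (serreLevel E)) : ℝ)) := by
    rw [div_eq_iff hpos, div_eq_iff (by positivity)]
    have hk' : (koblitzCount (galImage b (serreLevel E)) : ℝ) =
        (glSum (serreLevel E) (koblitzInd (serreLevel E)) : ℝ) * (1 +
          ((glSum (serreLevel E) fun A => koblitzInd (serreLevel E) A *
          psi (sfDisc E) (two_dvd_serreLevel E) A : ℤ) : ℝ) /
            (glSum (serreLevel E) (koblitzInd (serreLevel E)) : ℝ)) / 2 := by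
      field_simp
      linarith
    rw [hk']
    nth_rewrite 1 [hd]
    ring
  rw [key]
  ring

theorem cyclicTerm_eq (k : ℕ+) : cyclicTerm b k =
    moebiusTerm k + if (serreLevel E : ℕ) ∣ k then moebiusTerm k else 0 := by
  rw [cyclicTerm, moebiusTerm]
  split_ifs with hk
  · rw [← two_mul_card_galImage S b hE hk]
    push_cast
    rw [← add_div, ← two_mul, mul_div_mul_left _ _ two_ne_zero]
  · rw [galImage_eq_top S b hE hk, Subgroup.card_top, add_zero]

theorem cyclicTerm_eq_comp : cyclicTerm b =
    (fun n => moebiusTerm n + if (serreLevel E : ℕ) ∣ n then moebiusTerm n else 0) ∘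
      ((↑) : ℕ+ → ℕ) :=
  funext (cyclicTerm_eq S b hE)

theorem summable_cyclicTerm : Summable (cyclicTerm b) := by
  rw [cyclicTerm_eq_comp S b hE]
  exact (summable_moebiusTerm.of_norm.add (summable_ite_dvd_moebiusTerm _)).comp_injective
    PNat.coe_injective

theorem cyclicConst_eq : cyclicConst b =
    avgCyclicConst + moebiusTerm (serreLevel E) * ∑' n, moebiusTermAway (serreLevel E) n := by
  have hsum := summable_ite_dvd_moebiusTerm (serreLevel E)
  rw [cyclicConst, cyclicTerm_eq_comp S b hE]
  refine (PNat.coe_injective.tsum_eq (f := fun n =>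
    moebiusTerm n + if (serreLevel E : ℕ) ∣ n then moebiusTerm n else 0) ?_).trans ?_
  -- The term at n = 0 vanishes, so summing over ℕ instead of the positive integers changes nothing.
  · intro n hn
    refine ⟨⟨n, Nat.pos_of_ne_zero ?_⟩, rfl⟩
    rintro rfl
    exact hn (by simp [moebiusTerm_zero])
  rw [summable_moebiusTerm.of_norm.tsum_add hsum,
    tsum_ite_dvd_moebiusTerm _ (serreLevel E).ne_zero]
  congr 1
  -- The full series is the case of modulus 1, where no Euler factor is removed.
  have h1 : moebiusTermAway 1 = moebiusTerm :=
    funext fun n => if_pos (Nat.coprime_one_right n)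
  rw [← h1, tsum_moebiusTermAway, avgCyclicConst]
  exact tprod_congr fun l => if_neg fun hl => l.2.one_lt.ne' (Nat.dvd_one.mp hl)

end SerreCurve

end

/-! ### Convergence and the three formulas -/

open SerreCurve in
theorem mainTheorem3 (E : WeierstrassCurve ℚ) [E.IsElliptic] (hE : IsSerreCurve E)
    (b : TorsionBasis E) :
    -- convergence of the products and of the series
    (∀ r : ℤ, Multipliable (avgLangTrotterFactor r) ∧
      Multipliable (fun l : {l : Nat.Primes // ¬ (l : ℕ) ∣ minLevel b} =>
        langTrotterFactor r l)) ∧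
    (Multipliable avgKoblitzFactor ∧
      Multipliable (fun l : {l : Nat.Primes // ¬ (l : ℕ) ∣ minLevel b} => koblitzFactor l)) ∧
    (Multipliable avgCyclicFactor ∧ Summable (cyclicTerm b)) ∧
    -- the Lang–Trotter constant
    (∀ r : ℤ, langTrotterConst b r =
      if (2 : ℤ) ^ (twoExp (sfDisc E) - 1) ∣ r then
        avgLangTrotterConst r *
          (1 + (deltaSign (sfDisc E) r : ℝ) *
            (((serreLevel E : ℕ) : ℝ) * 2 ^ (twoExp (sfDisc E) - 1) *
              (Nat.totient (Nat.gcd (oddPart (sfDisc E)) r.natAbs) : ℝ) /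
              (traceCount (⊤ : Subgroup (GL (Fin 2) (ZMod (serreLevel E)))) r : ℝ)))
      else avgLangTrotterConst r) ∧
    -- the Koblitz constant
    (koblitzConst b =
      if sfDisc E % 4 = 1 then
        avgKoblitzConst *
          (1 + ∏ p ∈ (sfDisc E).natAbs.primeFactors,
            1 / ((p : ℝ) ^ 3 - 2 * (p : ℝ) ^ 2 - (p : ℝ) + 3))
      else avgKoblitzConst) ∧
    -- the cyclicity constant
    (cyclicConst b =
      if sfDisc E % 4 = 1 then
        avgCyclicConst *
          (1 + (ArithmeticFunction.moebius (serreLevel E : ℕ) : ℝ) /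
            ∏ l ∈ (serreLevel E : ℕ).primeFactors,
              ((Nat.card (GL (Fin 2) (ZMod l)) : ℝ) - 1))
      else avgCyclicConst) := by
  obtain ⟨h, q, W, χ, S⟩ := exists_splitting (sfDisc_squarefree E)
  have hd := sfDisc_squarefree E
  refine ⟨fun r => ⟨multipliable_of_summable_sub_one (summable_avgLangTrotter r), ?_⟩,
    ⟨multipliable_of_summable_sub_one summable_avgKoblitz, ?_⟩,
    ⟨multipliable_of_summable_sub_one summable_avgCyclic, summable_cyclicTerm S b hE⟩,
    fun r => ?_, ?_, ?_⟩
  · simp only [langTrotterFactor_eq]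
    exact multipliable_subtype (summable_avgLangTrotter r) _
  · simp only [koblitzFactor_eq]
    exact multipliable_subtype summable_avgKoblitz _
  · rw [langTrotterConst_eq S b hE r]
    have key := glSum_traceInd_psi_serreLevel S r
    rw [key]
    split_ifs
    · push_cast
      rw [mul_div_assoc]
    · rw [Int.cast_zero, zero_div, add_zero, mul_one]
  · rw [koblitzConst_eq S b hE]
    split_ifs with h1
    · rw [glSum_koblitzInd_psi_serreLevel S h1, mul_div_cancel_left₀]
      exact glSum_koblitzInd_serreLevel_ne_zero S
    · rw [glSum_koblitzInd_psi_serreLevel_eq_zero S h1, Int.cast_zero, zero_div, add_zero, mul_one]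
  · rw [cyclicConst_eq S b hE, moebiusTerm_mul_tsum _ (serreLevel E).ne_zero]
    split_ifs with h1
    · ring
    -- When d is not 1 modulo 4 the level is divisible by 4, so the correction vanishes with μ(M).
    · rw [moebius_serreLevel h1, Int.cast_zero, zero_div, mul_zero, add_zero]
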